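/- Let $c\in\mathbb C^\times$ and put $g(u,v)=\frac{c}{u-v}$, $f(u,v)=1+g(u,v)$, $h(u,v)=\frac{f(u,v)}{g(u,v)}=\frac{u-v+c}{c}$. Grade the indices by $[1]=0$, $[2]=[3]=1$; let $\mathrm E_{ij}$, of degree $[i]+[j]$, be the elementary matrices of $\mathrm{End}(\mathbb C^{1|2})$, let all tensor products be graded, let $\mathrm{str}(\mathrm E_{ij})=(-1)^{[j]}\delta_{ij}$, $P=\sum_{i,j}(-1)^{[j]}\mathrm E_{ij}\otimes \mathrm E_{ji}$ and $R(u,v)=\mathbb I+g(u,v)P$. The super-Yangian $Y(1|2)$ is the unital algebra generated by the modes $\widetilde T_{ij}^{(p)}$ ($1\le i,j\le 3$, $p\ge 0$) of $$\widetilde T(u)=\sum_{i,j}\mathrm E_{ij}\otimes \widetilde T_{ij}(u),\qquad \widetilde T_{ij}(u)=\delta_{ij}+\sum_{p\ge0}\widetilde T_{ij}^{(p)}\Big(\frac cu\Big)^{p+1},$$ with the relations $R_{12}(u,v)\widetilde T_1(u)\widetilde T_2(v)=\widetilde T_2(v)\widetilde T_1(u)R_{12}(u,v)$, that is, $$\widetilde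 T_{ij}(u)\widetilde T_{kl}(v)-(-1)^{([i]+[j])([k]+[l])}\widetilde T_{kl}(v)\widetilde T_{ij}(u)=(-1)^{[l]([i]+[j])+[i][j]}g(u,v)\big(\widetilde T_{il}(u)\widetilde T_{kj}(v)-\widetilde T_{il}(v)\widetilde T_{kj}(u)\big).$$ Let $\Omega$ be a singular vector of a representation of $Y(1|2)$: $\widetilde T_{ii}(u)\Omega=\widetilde\lambda_i(u)\Omega$ and $\widetilde T_{ij}(u)\Omega=0$ for $i>j$. For ordered sets $\bar u=\{u_1,\dots,u_a\}$ and $\bar v=\{v_1,\dots,v_b\}$ of pairwise distinct parameters with $H(\bar u)=\prod_{1\le k<j\le a}h(u_j,u_k)\neq0$, define the Bethe vector $$\widetilde\Phi_{a,b}(\bar u,\bar v)=\frac{(-1)^a}{H(\bar u)}\,\mathrm{str}_{1\cdots a+b}\Big[\widetilde T_1(u_1)\cdots\widetilde T_a(u_a)\,\widetilde T_{a+1}(v_1)\cdots\widetilde T_{a+b}(v_b)\,\mathbb R_{1\dots a+b}\,\mathrm E_{21}^{(1)}\cdots \mathrm E_{21}^{(a)}\mathrm E_{32}^{(a+1)}\cdots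 \mathrm E_{32}^{(a+b)}\Big]\Omega,$$ where $\mathbb R_{1\dots a+b}=(R_{a+1,a}\cdots R_{a+1,1})(R_{a+2,a}\cdots R_{a+2,1})\cdots(R_{a+b,a}\cdots R_{a+b,1})$ with $R_{a+j,k}=R_{a+j,k}(v_j,u_k)$. Then, for all $a\ge1$ and $b\ge0$, $$\widetilde\Phi_{a,b}(\bar u,\bar v)=h(\bar u_1,u_1)^{-1}\,\widetilde T_{12}(u_1)\,\widetilde\Phi_{a-1,b}(\bar u_1,\bar v)-h(\bar u_1,u_1)^{-1}\sum_{j=1}^b\widetilde\lambda_2(v_j)\,g(u_1,v_j)\,f(\bar u_1,v_j)\,f(v_j,\bar v_j)\,\widetilde T_{13}(u_1)\,\widetilde\Phi_{a-1,b-1}(\bar u_1,\bar v_j),$$ where $\bar u_1=\bar u\setminus\{u_1\}$, $\bar v_j=\bar v\setminus\{v_j\}$ (with the induced order), and a function with a set as argument stands for the product over the elements of the set. The identity holds both for formal parameters, with $\widetilde T_{ij}(u)$ the generating series (scalars, operators and vectors being expanded as iterated Laurent series in the inverse parameters, in any order), and for complex parameters, in every representation of the above $RTT$ relations by operators $\widetilde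 T_{ij}(u)$ defined for $u$ in a set $D\subseteq\mathbb C$ (the relations being required for $u\ne v$ in $D$), with a singular vector $\Omega$, when all parameters lie in $D$. -/

import Mathlib

open scoped BigOperators

namespace SuperYangian

/-! ## Grading, rational functions -/

/-- The `ℤ₂`-grading of `ℂ^{1|2}`, with the indices `1, 2, 3` written `0, 1, 2`:
`[1] = 0`, `[2] = [3] = 1`. -/
def gr : Fin 3 → ℕ := ![0, 1, 1]

section Rational
variable {K : Type*} [Field K]

/-- `g(u,v) = c / (u - v)`. -/
def g (c u v : K) : K := c / (u - v)

/-- `f(u,v) = 1 + g(u,v)`. -/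
def f (c u v : K) : K := 1 + g c u v

/-- `h(u,v) = f(u,v) / g(u,v) = (u - v + c) / c`. -/
def h (c u v : K) : K := (u - v + c) / c

end Rational

/-- The tuple `w` with its entry `w j` removed, the order of the others being kept. -/
def remove {S : Type*} {b : ℕ} (w : Fin b → S) (j : Fin b) : Fin (b - 1) → S := fun i =>
  if (i : ℕ) < (j : ℕ) then w ⟨i, by omega⟩ else w ⟨i + 1, by omega⟩

/-! ## Auxiliary spaces

The graded tensor product `End(ℂ^{1|2})^{⊗ N} ⊗ A` acts on `(ℂ^{1|2})^{⊗ N} ⊗ A` by the rule of signs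
`(x ⊗ y) (v ⊗ w) = (-1)^{[y][v]} x v ⊗ y w`.
Its elements are written as matrices with entries in `A`, with respect to the basis
`e_J = e_{J 0} ⊗ e_{J 1} ⊗ ⋯`, `J : Fin N → Fin 3`; the graded product is then the
product of matrices. The algebra `A` is the last (rightmost) factor. -/

/-- Matrices over `A` indexed by the basis of `(ℂ^{1|2})^{⊗ N}`. -/
abbrev AuxMat (N : ℕ) (A : Type*) := Matrix (Fin N → Fin 3) (Fin N → Fin 3) A

section Aux
variable {A : Type*} [Ring A] {N : ℕ}

/-- The degree (taken in `ℕ`, relevant modulo `2`) of the basis vector `e_J`. -/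
def deg (J : Fin N → Fin 3) : ℕ := ∑ p, gr (J p)

/-- The elementary matrix `E_{ij}^{(p)}` in the `p`-th auxiliary space. On `e_J` it is
`E_{ij}` on the `p`-th factor, with the sign from passing the factors to the left of it. -/
def E (i j : Fin 3) (p : Fin N) : AuxMat N A :=
  Matrix.of fun I J =>
    if J p = j ∧ I = Function.update J p i then
      (-1) ^ ((gr i + gr j) * ∑ q ∈ Finset.Iio p, gr (J q))
    else 0

/-- `𝕀 ⊗ x` for `x ∈ A` of degree `ε`: on `e_J` it is `x` with the sign from passing `e_J`. -/
def incl (ε : ℕ) (x : A) : AuxMat N A :=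
  Matrix.diagonal fun J => (-1) ^ (ε * deg J) * x

/-- `T_p = ∑ E_{ij}^{(p)} ⊗ T_{ij}`, where `T_{ij}` has degree `[i] + [j]`. -/
def auxT (T : Fin 3 → Fin 3 → A) (p : Fin N) : AuxMat N A :=
  ∑ i, ∑ j, E i j p * incl (gr i + gr j) (T i j)

/-- The graded permutation `P_{pq} = ∑ (-1)^{[j]} E_{ij}^{(p)} E_{ji}^{(q)}`. -/
def perm (p q : Fin N) : AuxMat N A :=
  ∑ i, ∑ j, (-1) ^ gr j * (E i j p * E j i q)

/-- The `R`-matrix `R_{pq} = 𝕀 + t P_{pq}`; here `t` stands for the value of `g`. -/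
def rMat {K : Type*} [CommSemiring K] [Algebra K A] (t : K) (p q : Fin N) : AuxMat N A :=
  1 + t • perm p q

/-- The super-trace over all auxiliary spaces of an element `X` of total degree `ε`.
The component of `X` on `E_{J₀J₀} ⊗ E_{J₁J₁} ⊗ ⋯` is an element `x` of `A` of degree `ε`,
and the diagonal entry of the matrix `X` at `J` is `(-1)^{ε [J]} x`, so that
`x = (-1)^{ε [J]} X J J`; this `x` is counted with the sign `(-1)^{[J]}`. -/
def superTrace (ε : ℕ) (X : AuxMat N A) : A :=
  ∑ J, (-1) ^ deg J * ((-1) ^ (ε * deg J) * X J J)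

end Aux

/-! ## Bethe vectors

`S` is a set of labels of spectral parameters, `z s` is the value of the parameter `s`, and
`T s` is the monodromy matrix at this value. -/

section Bethe
variable {K A S : Type*} [Field K] [Ring A] [Algebra K A]

/-- `H(ū) = ∏_{k < j} h(u_j, u_k)`. -/
def bigH (c : K) {a : ℕ} (w : Fin a → K) : K :=
  ∏ j, ∏ k ∈ Finset.Iio j, h c (w j) (w k)

/-- `(R_{a+1,a} ⋯ R_{a+1,1}) (R_{a+2,a} ⋯ R_{a+2,1}) ⋯ (R_{a+b,a} ⋯ R_{a+b,1})` with
`R_{a+j,k} = R_{a+j,k}(v_j, u_k)`. -/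
def bigR (A : Type*) [Ring A] [Algebra K A] (c : K) {a b : ℕ} (u : Fin a → K) (v : Fin b → K) :
    AuxMat (a + b) A :=
  ((List.finRange b).map fun j =>
    ((List.finRange a).reverse.map fun k =>
      rMat (g c (v j) (u k)) (Fin.natAdd a j) (Fin.castAdd b k)).prod).prod

/-- The operator `Φ̃_{a,b}(ū, v̄)` given by the super-trace formula
`(-1)^a / H(ū) · str_{1…a+b} [T_1(u_1) ⋯ T_a(u_a) T_{a+1}(v_1) ⋯ T_{a+b}(v_b) 𝐑_{1…a+b}
  E_{21}^{(1)} ⋯ E_{21}^{(a)} E_{32}^{(a+1)} ⋯ E_{32}^{(a+b)}]`.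
As `T` and `R` are even, `E_{21}` is odd and `E_{32}` is even, the bracket has degree `a`. -/
def betheOp (c : K) (z : S → K) (T : S → Fin 3 → Fin 3 → A) {a b : ℕ}
    (u : Fin a → S) (v : Fin b → S) : A :=
  ((-1) ^ a / bigH c (fun k => z (u k))) •
    superTrace a
      (((List.finRange a).map fun k => auxT (T (u k)) (Fin.castAdd b k)).prod *
        ((List.finRange b).map fun j => auxT (T (v j)) (Fin.natAdd a j)).prod *
        bigR A c (fun k => z (u k)) (fun j => z (v j)) *
        ((List.finRange a).map fun k => E 1 0 (Fin.castAdd b k)).prod *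
        ((List.finRange b).map fun j => E 2 1 (Fin.natAdd a j)).prod)

/-- The Bethe vector `Φ̃_{a,b}(ū, v̄)`. -/
def betheVec {M : Type*} [AddCommGroup M] [Module A M] (c : K) (z : S → K)
    (T : S → Fin 3 → Fin 3 → A) (Ω : M) {a b : ℕ} (u : Fin a → S) (v : Fin b → S) : M :=
  betheOp c z T u v • Ω

end Bethe

/-! ## The super-Yangian `Y(1|2)` -/

/-- The graded commutator of `x` and `y`, of degrees `p` and `q`. -/
def scomm {B : Type*} [Ring B] (p q : ℕ) (x y : B) : B := x * y - (-1) ^ (p * q) * (y * x)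

/-- The relation obtained by projecting the `RTT` relation at the parameters with values `x`, `y`
on the elementary matrices, for monodromy matrices `Tx`, `Ty`. -/
def RTTRelation {K A : Type*} [Field K] [Ring A] [Algebra K A] (c x y : K)
    (Tx Ty : Fin 3 → Fin 3 → A) : Prop :=
  ∀ i j k l : Fin 3,
    scomm (gr i + gr j) (gr k + gr l) (Tx i j) (Ty k l) =
      ((-1) ^ (gr l * (gr i + gr j) + gr i * gr j) * g c x y) •
        (Tx i l * Ty k j - Ty i l * Tx k j)

/-- The free algebra on the generators `T_{ij}^{(p)}`, `p ≥ 0`. -/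
abbrev FreeModes := FreeAlgebra ℂ (Fin 3 × Fin 3 × ℕ)

/-- The coefficient of `(c/u)^n` in `T_{ij}(u) = δ_{ij} + ∑_{p ≥ 0} T_{ij}^{(p)} (c/u)^{p+1}`. -/
def freeCoeff (i j : Fin 3) : ℕ → FreeModes
  | 0 => if i = j then 1 else 0
  | p + 1 => FreeAlgebra.ι ℂ (i, j, p)

/-- The relations of `Y(1|2)`: the coefficients of `(c/u)^m (c/v)^n` in the identity
`(u - v)/c · [T_{ij}(u), T_{kl}(v)} =
  (-1)^{[l]([i]+[j])+[i][j]} (T_{il}(u) T_{kj}(v) - T_{il}(v) T_{kj}(u))`. -/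
inductive YRel : FreeModes → FreeModes → Prop
  | rtt (i j k l : Fin 3) (m n : ℕ) :
      YRel
        (scomm (gr i + gr j) (gr k + gr l) (freeCoeff i j (m + 1)) (freeCoeff k l n) -
          scomm (gr i + gr j) (gr k + gr l) (freeCoeff i j m) (freeCoeff k l (n + 1)))
        ((-1) ^ (gr l * (gr i + gr j) + gr i * gr j) *
          (freeCoeff i l m * freeCoeff k j n - freeCoeff i l n * freeCoeff k j m))

/-- The super-Yangian `Y(1|2)`. -/
abbrev Y := RingQuot YRel

/-- The coefficient of `(c/u)^n` in `T_{ij}(u)`, as an element of `Y(1|2)`. -/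
def coeffT (i j : Fin 3) (n : ℕ) : Y := RingQuot.mkAlgHom ℂ YRel (freeCoeff i j n)

/-! ## Formal spectral parameters

For `n` formal spectral parameters `u_0, …, u_{n-1}` put `x_s = c / u_s`. Scalars, elements of the
Yangian and vectors are formal series in the `x_s` with lexicographically well-ordered support:
this contains the power series in the `x_s` and the rational functions of the `u_s`. -/

/-- The ordered group of exponents of the monomials in `x_0, …, x_{n-1}`. -/
abbrev Expo (n : ℕ) := Lex (Fin n → ℤ)

/-- The field of scalar series. -/
abbrev Scal (n : ℕ) := HahnSeries (Expo n) ℂ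

/-- The algebra of series with coefficients in `Y(1|2)`. -/
abbrev YSer (n : ℕ) := HahnSeries (Expo n) Y

/-- Series with coefficients in a `Y(1|2)`-module `V`; a module over `YSer n`. -/
abbrev VSer (n : ℕ) (V : Type*) [AddCommGroup V] [Module Y V] := HahnModule (Expo n) Y V

/-- A scalar series as a series with coefficients in `ℂ ⊆ Y(1|2)`. -/
noncomputable def scalarMap (n : ℕ) : Scal n →+* YSer n where
  toFun x := x.map (algebraMap ℂ Y)
  map_one' := by
    ext γ
    by_cases hγ : γ = 0 <;> simp [HahnSeries.coeff_one, hγ]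
  map_mul' x y := HahnSeries.map_mul ((algebraMap ℂ Y : ℂ →+* Y) : ℂ →ₙ+* Y) (x := x) (y := y)
  map_zero' := by ext γ; simp
  map_add' x y := by ext γ; simp

theorem scalarMap_commute (n : ℕ) (x : Scal n) (y : YSer n) :
    scalarMap n x * y = y * scalarMap n x := by
  ext γ
  have hx : (scalarMap n x).support ⊆ x.support := by
    intro δ hδ hx
    exact hδ (by change algebraMap ℂ Y (x.coeff δ) = 0; rw [hx, map_zero])
  rw [HahnSeries.coeff_mul_left' x.isPWO_support hx, HahnSeries.coeff_mul_right' x.isPWO_support hx]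
  exact Finset.sum_equiv (Equiv.prodComm _ _) (fun _ => Finset.swap_mem_antidiagonal.symm)
    (fun p _ => Algebra.commutes (x.coeff p.1) (y.coeff p.2))

noncomputable instance (n : ℕ) : Algebra (Scal n) (YSer n) :=
  (scalarMap n).toAlgebra' (scalarMap_commute n)

/-- Multiplication of vectors by scalar series. -/
noncomputable instance (n : ℕ) (V : Type*) [AddCommGroup V] [Module Y V] :
    Module (Scal n) (VSer n V) :=
  Module.compHom (VSer n V) (scalarMap n)

/-- The exponents of the powers of `x_s`. -/
noncomputable def powEmb (n : ℕ) (s : Fin n) : ℕ ↪o Expo n :=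
  OrderEmbedding.ofStrictMono (fun k => toLex (Pi.single s (k : ℤ))) (by
    intro k l hkl
    refine Pi.toLex_strictMono (Pi.lt_def.2 ⟨fun i => ?_, s, by simpa using hkl⟩)
    by_cases hi : i = s
    · subst hi
      simpa using hkl.le
    · simp [hi])

/-- The series `∑_k q_k x_s^k`. -/
noncomputable def seriesIn {B : Type*} [Zero B] (n : ℕ) (s : Fin n) (q : ℕ → B) :
    HahnSeries (Expo n) B :=
  HahnSeries.embDomain (powEmb n s) ⟨q, Set.isPWO_of_wellQuasiOrderedLE _⟩

/-- The formal spectral parameter `u_s = c / x_s`. -/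
noncomputable def formalParam (c : ℂ) (n : ℕ) (s : Fin n) : Scal n :=
  HahnSeries.C c / HahnSeries.single (powEmb n s 1) 1

/-- The generating series `T_{ij}(u_s)`. -/
noncomputable def formalT (n : ℕ) (s : Fin n) (i j : Fin 3) : YSer n :=
  seriesIn n s (coeffT i j)

/-- The series `λ(u_s) = ∑_k λ_k (c/u_s)^k`. -/
noncomputable def formalLam (n : ℕ) (lam : ℕ → ℂ) (s : Fin n) : Scal n := seriesIn n s lam

/-- A vector of `V` as a constant series. -/
noncomputable def constVec (n : ℕ) {V : Type*} [AddCommGroup V] [Module Y V] (Ω : V) : VSer n V :=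
  HahnModule.of Y (HahnSeries.single 0 Ω)

/-- `g(u_s, u_t)`. -/
noncomputable def formalG (c : ℂ) (n : ℕ) (s t : Fin n) : Scal n :=
  g (HahnSeries.C c) (formalParam c n s) (formalParam c n t)

/-- `f(u_s, u_t)`. -/
noncomputable def formalF (c : ℂ) (n : ℕ) (s t : Fin n) : Scal n :=
  f (HahnSeries.C c) (formalParam c n s) (formalParam c n t)

/-- `h(u_s, u_t)`. -/
noncomputable def formalH (c : ℂ) (n : ℕ) (s t : Fin n) : Scal n :=
  h (HahnSeries.C c) (formalParam c n s) (formalParam c n t)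

/-- The Bethe vector of `Y(1|2)` whose parameters are the formal `u_s` with `s` running through
the tuples `u` and `v`. -/
noncomputable def formalBethe (c : ℂ) (n : ℕ) {V : Type*} [AddCommGroup V] [Module Y V] (Ω : V)
    {a b : ℕ} (u : Fin a → Fin n) (v : Fin b → Fin n) : VSer n V :=
  betheVec (HahnSeries.C c) (formalParam c n) (formalT n) (constVec n Ω) u v

end SuperYangian

/-! Indices are numbered 1, 2, 3 as in the theorem; `Fin 2` labels the odd indices 2, 3.

The super-trace has one surviving diagonal entry. The product of the `E_{21}` and `E_{32}` kills
every basis vector except the one of the word `1^a 2^b`, which it sends to that of `2^a 3^b`. All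
indices of the latter are odd, and on odd indices the graded permutation is minus the ordinary flip,
so the R-matrices become `1 - g · flip`. The monodromy matrices then contribute row 1 at each `u_k`
and row 2 at each `v_j`, and all signs collect into `(-1)^b` (`betheOp_eq`). Hence the Bethe vector
is, up to `(-1)^b / H(ū)`, the sum over words `J` in `{2,3}^a` of `T_{1,J_1}(u_1) ⋯ T_{1,J_a}(u_a)`
applied to the component `J` of `B(v_1) ⋯ B(v_b) (e_2 ⊗ ⋯ ⊗ e_2 ⊗ Ω)`. Here `A`, `B` are the entries
`T_{22}`, `T_{23}` of the second row, dressed by the R-matrices with the spaces of the `u_k`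
(`sum_oddBigR_smul`, `betheVec_eq`).

The recursion comes from splitting the sum by `J_1`. The operator `T_{12}(u_1)` or `T_{13}(u_1)` is
already leftmost, so only the components of the state in the first auxiliary space are needed. For
`J_1 = 2` this is the same state without `u_1` (`slice_zero_dressedCreation`). For `J_1 = 3` exactly
one of the `B(v_j)` has been turned into `A(v_j)`, with weight `g(u_1,v_j) ∏_{i<j} f(u_1,v_i)`
(`slice_one_dressedCreation`). The dressed row still obeys the exchange relations
(`RowExchange.dressed`), and `e_2 ⊗ ⋯ ⊗ e_2 ⊗ Ω` is an eigenvector of the dressed `A`. Moving `A` to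
the right as in the algebraic Bethe ansatz, the unwanted terms recombine by a three-term identity
for `g`, and each `j` contributes a single product with `v_j` removed (`insertion_eq`).

The algebra is done over an arbitrary field of characteristic zero (`betheVec_succ`). It is applied
to complex parameters, and to formal ones over a field of Hahn series, where the exchange relation
is recovered from the mode relations. -/

namespace SuperYangian

/-! ### Removing an entry from a tuple. -/

section Tuples

variable {S : Type*}

theorem remove_zero {b : ℕ} (v : Fin (b + 1) → S) : remove v 0 = Fin.tail v := by
  funext i
  simp [remove, Fin.tail, Fin.succ]

theorem remove_succ_zero {b : ℕ} (v : Fin (b + 2) → S) (j : Fin (b + 1)) :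
    remove v j.succ (0 : Fin (b + 1)) = v 0 := by
  simp [remove]

theorem tail_remove_succ {b : ℕ} (v : Fin (b + 2) → S) (j : Fin (b + 1)) :
    Fin.tail (n := b) (α := fun _ => S) (remove v j.succ) = remove (Fin.tail v) j := by
  funext i
  simp only [remove, Fin.tail, Fin.val_succ, Nat.add_lt_add_iff_right]
  split_ifs <;> rfl

theorem prod_remove_succ {K : Type*} [CommMonoid K] (F : S → K) {b : ℕ} (v : Fin (b + 1) → S)
    (j : Fin b) :
    ∏ k, F (remove v j.succ k) = F (v 0) * ∏ k, F (remove (Fin.tail v) j k) := by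
  cases b with
  | zero => exact j.elim0
  | succ b =>
    rw [← tail_remove_succ v j, ← remove_succ_zero v j]
    exact Fin.prod_univ_succ (n := b) (fun k => F (remove v j.succ k))

theorem prod_remove_zero {K : Type*} [CommMonoid K] (F : S → K) {b : ℕ} (v : Fin (b + 1) → S) :
    ∏ k, F (remove v 0 k) = ∏ i : Fin b, F (v i.succ) := by
  rw [remove_zero]
  rfl

end Tuples

/-! ### Rational identities for `g` and `f`. -/

section Scalars

variable {K : Type*} [Field K] (c : K)

theorem g_swap (x y : K) : g c y x = -g c x y := by
  rw [g, g, ← neg_sub x y, div_neg]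

theorem f_swap (x y : K) : f c y x = 1 - g c x y := by
  rw [f, g_swap, sub_eq_add_neg]

/-- This three-term identity, from `(x - y) + (y - w) = x - w`, is what makes the unwanted terms
recombine in both Bethe ansatz inductions. -/
theorem g_mul_g_add {x y w : K} (hxy : x ≠ y) (hyw : y ≠ w) (hxw : x ≠ w) :
    g c x y * g c y w = g c x w * (g c x y + g c y w) := by
  have h₁ := sub_ne_zero.2 hxy
  have h₂ := sub_ne_zero.2 hyw
  have h₃ := sub_ne_zero.2 hxw
  unfold g
  field_simp
  ring

end Scalars

/-! ### Algebraic Bethe ansatz for one row with exchange relations. -/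

section Creation

variable {K W S : Type*} [Field K] [AddCommGroup W] [Module K W]

/-- The vector `B(v₀) B(v₁) ⋯ ω`. -/
def creation (B : S → Module.End K W) (ω : W) : {b : ℕ} → (Fin b → S) → W
  | 0, _ => ω
  | _ + 1, v => B (v 0) (creation B ω (Fin.tail v))

theorem creation_succ (B : S → Module.End K W) (ω : W) {b : ℕ} (v : Fin (b + 1) → S) :
    creation B ω v = B (v 0) (creation B ω (Fin.tail v)) := rfl

theorem creation_remove_succ (B : S → Module.End K W) (ω : W) {b : ℕ} (v : Fin (b + 1) → S)
    (j : Fin b) :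
    creation B ω (remove v j.succ) = B (v 0) (creation B ω (remove (Fin.tail v) j)) := by
  cases b with
  | zero => exact j.elim0
  | succ b =>
    rw [← tail_remove_succ v j, ← remove_succ_zero v j]
    rfl

/-- The exchange relations, for parameters in `D`, of the entries `t₀, t₁` of a row of a monodromy
matrix. -/
def RowExchange (c : K) (z : S → K) (D : Set S) (t : S → Fin 2 → Module.End K W) : Prop :=
  ∀ r ∈ D, ∀ s ∈ D, r ≠ s → ∀ j l, ∀ x : W,
    t r j (t s l x) - t s l (t r j x) =
      g c (z r) (z s) • (t s l (t r j x) - t r l (t s j x))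

variable {c : K} {z : S → K} {D : Set S} {t : S → Fin 2 → Module.End K W}

theorem RowExchange.zero_one (ht : RowExchange c z D t) {r s : S} (hr : r ∈ D) (hs : s ∈ D)
    (hrs : r ≠ s) (x : W) :
    t r 0 (t s 1 x) =
      f c (z r) (z s) • t s 1 (t r 0 x) + g c (z s) (z r) • t r 1 (t s 0 x) := by
  rw [sub_eq_iff_eq_add.1 (ht r hr s hs hrs 0 1 x), g_swap c (z r) (z s), f]
  module

/-- For equal columns the commutator `X` satisfies both `X = -g X` and, after exchanging the
parameters, `X = g X`; hence `2 X = 0`. -/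
theorem RowExchange.diag [CharZero K] (ht : RowExchange c z D t) {r s : S} (hr : r ∈ D)
    (hs : s ∈ D) (hrs : r ≠ s) (j : Fin 2) (x : W) :
    t r j (t s j x) = t s j (t r j x) := by
  have h₁ := ht r hr s hs hrs j j x
  have h₂ := ht s hs r hr hrs.symm j j x
  rw [g_swap c (z r) (z s)] at h₂
  have h₃ : t r j (t s j x) - t s j (t r j x) = t s j (t r j x) - t r j (t s j x) :=
    h₁.trans ((h₂.trans (by module)).symm)
  have h₄ : (2 : K) • (t r j (t s j x) - t s j (t r j x)) = 0 := by
    rw [two_smul]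
    nth_rewrite 1 [h₃]
    abel
  exact sub_eq_zero.1 ((smul_eq_zero.1 h₄).resolve_left two_ne_zero)

variable {α : S → K} {ω : W}

/-- The action of `A(r)` on `B(v_0) B(v_1) ⋯ ω`, by moving `A(r)` past `B(v_0)`. This leaves `A(r)`
or `A(v_0)` on the remaining product, and both are known by induction. -/
theorem diagonal_creation [CharZero K] (hz : Set.InjOn z D) (ht : RowExchange c z D t)
    (hω : ∀ s ∈ D, t s 0 ω = α s • ω) {b : ℕ} (v : Fin b → S) (r : S) (hr : r ∈ D)
    (hv : ∀ i, v i ∈ D) (hrv : ∀ i, r ≠ v i) (hinj : Function.Injective v) :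
    t r 0 (creation (fun s => t s 1) ω v) =
      (α r * ∏ i, f c (z r) (z (v i))) • creation (fun s => t s 1) ω v +
        ∑ j, (α (v j) * g c (z (v j)) (z r) * ∏ k, f c (z (v j)) (z (remove v j k))) •
          t r 1 (creation (fun s => t s 1) ω (remove v j)) := by
  induction b generalizing r with
  | zero => simp [creation, hω r hr]
  | succ b ih =>
    have htail : Function.Injective (Fin.tail v) := hinj.comp (Fin.succ_injective _)
    have h0 : ∀ i, v 0 ≠ Fin.tail v i := fun i h => (Fin.succ_ne_zero i) (hinj h).symm
    rw [creation_succ, ht.zero_one hr (hv 0) (hrv 0),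
      ih (Fin.tail v) r hr (fun i => hv _) (fun i => hrv _) htail,
      ih (Fin.tail v) (v 0) (hv 0) (fun i => hv _) h0 htail, Fin.prod_univ_succ,
      Fin.sum_univ_succ,
      prod_remove_zero (fun s => f c (z (v 0)) (z s)), remove_zero]
    have hterm : ∀ j : Fin b,
        (α (v j.succ) * g c (z (v j.succ)) (z r) *
            ∏ k, f c (z (v j.succ)) (z (remove v j.succ k))) •
          t r 1 (creation (fun s => t s 1) ω (remove v j.succ)) =
        f c (z r) (z (v 0)) • t (v 0) 1 ((α (Fin.tail v j) * g c (z (Fin.tail v j)) (z r) *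
            ∏ k, f c (z (Fin.tail v j)) (z (remove (Fin.tail v) j k))) •
          t r 1 (creation (fun s => t s 1) ω (remove (Fin.tail v) j))) +
        g c (z (v 0)) (z r) • t r 1 ((α (Fin.tail v j) * g c (z (Fin.tail v j)) (z (v 0)) *
            ∏ k, f c (z (Fin.tail v j)) (z (remove (Fin.tail v) j k))) •
          t (v 0) 1 (creation (fun s => t s 1) ω (remove (Fin.tail v) j))) := by
      intro j
      rw [creation_remove_succ, prod_remove_succ (fun s => f c (z (v j.succ)) (z s)),
        map_smul, map_smul, ht.diag (hv 0) hr (hrv 0).symm]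
      have h₁ : z (v 0) ≠ z r := fun h => (hrv 0).symm (hz (hv 0) hr h)
      have h₂ : z (v j.succ) ≠ z r := fun h => (hrv _).symm (hz (hv _) hr h)
      have h₃ : z (v j.succ) ≠ z (v 0) := fun h => (h0 j).symm (hz (hv _) (hv _) h)
      -- The two contributions containing `B(r) B(v_0)` match by `f(r,v_0) g(v_j,r) + g(v_0,r)
      -- g(v_j,v_0) = g(v_j,r) f(v_j,v_0)`.
      have key := g_mul_g_add c h₃ h₁ h₂
      have hf := g_swap c (z (v 0)) (z r)
      have e : v j.succ = Fin.tail v j := rfl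
      rw [e] at key ⊢
      simp only [smul_smul, ← add_smul]
      congr 1
      generalize ∏ k, f c (z (Fin.tail v j)) (z (remove (Fin.tail v) j k)) = p
      simp only [f]
      rw [hf]
      linear_combination (-α (Fin.tail v j) * p) * key
    simp only [hterm, Finset.sum_add_distrib, map_add, map_sum, map_smul, smul_add,
      Finset.smul_sum]
    simp only [smul_smul, Fin.tail]
    module

/-- The sum `∑ⱼ g(x,vⱼ) ∏_{i<j} f(x,vᵢ) B(v₀) ⋯ A(vⱼ) ⋯ B(v_{b-1}) ω`. -/
def insertion (c : K) (z : S → K) (t : S → Fin 2 → Module.End K W) (ω : W) (x : K) :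
    {b : ℕ} → (Fin b → S) → W
  | 0, _ => 0
  | _ + 1, v => g c x (z (v 0)) • t (v 0) 0 (creation (fun s => t s 1) ω (Fin.tail v)) +
      f c x (z (v 0)) • t (v 0) 1 (insertion c z t ω x (Fin.tail v))

/-- Applying `A(v_j)` to the `B`s on its right yields triangular sums. The coefficients combine by
`g(x,v_0) g(v_j,v_0) + f(x,v_0) g(x,v_j) = g(x,v_j) f(v_j,v_0)`, so the asymmetric weight `∏_{i<j}
f(x,v_i)` disappears. -/
theorem insertion_eq [CharZero K] (hz : Set.InjOn z D) (ht : RowExchange c z D t)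
    (hω : ∀ s ∈ D, t s 0 ω = α s • ω) (x : K) {b : ℕ} (v : Fin b → S)
    (hv : ∀ i, v i ∈ D) (hx : ∀ i, x ≠ z (v i)) (hinj : Function.Injective v) :
    insertion c z t ω x v =
      ∑ j, (α (v j) * g c x (z (v j)) * ∏ k, f c (z (v j)) (z (remove v j k))) •
        creation (fun s => t s 1) ω (remove v j) := by
  induction b with
  | zero => simp [insertion]
  | succ b ih =>
    have htail : Function.Injective (Fin.tail v) := hinj.comp (Fin.succ_injective _)
    have h0 : ∀ i, v 0 ≠ Fin.tail v i := fun i h => (Fin.succ_ne_zero i) (hinj h).symm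
    rw [insertion, diagonal_creation hz ht hω (Fin.tail v) (v 0) (hv 0) (fun i => hv _) h0 htail,
      ih (Fin.tail v) (fun i => hv _) (fun i => hx _) htail, Fin.sum_univ_succ,
      prod_remove_zero (fun s => f c (z (v 0)) (z s)), remove_zero]
    have hterm : ∀ j : Fin b,
        (α (v j.succ) * g c x (z (v j.succ)) *
            ∏ k, f c (z (v j.succ)) (z (remove v j.succ k))) •
          creation (fun s => t s 1) ω (remove v j.succ) =
        g c x (z (v 0)) • (α (Fin.tail v j) * g c (z (Fin.tail v j)) (z (v 0)) *
            ∏ k, f c (z (Fin.tail v j)) (z (remove (Fin.tail v) j k))) •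
          t (v 0) 1 (creation (fun s => t s 1) ω (remove (Fin.tail v) j)) +
        f c x (z (v 0)) • (α (Fin.tail v j) * g c x (z (Fin.tail v j)) *
            ∏ k, f c (z (Fin.tail v j)) (z (remove (Fin.tail v) j k))) •
          t (v 0) 1 (creation (fun s => t s 1) ω (remove (Fin.tail v) j)) := by
      intro j
      rw [creation_remove_succ, prod_remove_succ (fun s => f c (z (v j.succ)) (z s))]
      have h₃ : z (v j.succ) ≠ z (v 0) := fun h => (h0 j).symm (hz (hv _) (hv _) h)
      have key := g_mul_g_add c (hx j.succ) h₃ (hx 0)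
      have e : v j.succ = Fin.tail v j := rfl
      rw [e] at key ⊢
      simp only [smul_smul, ← add_smul]
      congr 1
      generalize ∏ k, f c (z (Fin.tail v j)) (z (remove (Fin.tail v) j k)) = p
      simp only [f]
      linear_combination (α (Fin.tail v j) * p) * key
    simp only [hterm, Finset.sum_add_distrib, map_sum, map_smul, smul_add,
      Finset.smul_sum]
    simp only [smul_smul, Fin.tail]
    module

end Creation

/-! ### The row dressed by R-matrices, and its components in the first auxiliary space. -/

section Dressing

variable {K M S : Type*} [Field K] [AddCommGroup M] [Module K M]

/-- The component of a state with the first auxiliary index equal to `κ`. -/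
def slice (K : Type*) {M : Type*} [Field K] [AddCommGroup M] [Module K M] {a : ℕ} (κ : Fin 2) :
    ((Fin (a + 1) → Fin 2) → M) →ₗ[K] ((Fin a → Fin 2) → M) :=
  LinearMap.funLeft K M fun J => Fin.cons κ J

theorem slice_apply {a : ℕ} (κ : Fin 2) (ψ : (Fin (a + 1) → Fin 2) → M) (J : Fin a → Fin 2) :
    slice K κ ψ J = ψ (Fin.cons κ J) := rfl

theorem slice_ext {a : ℕ} {ψ φ : (Fin (a + 1) → Fin 2) → M}
    (h : ∀ κ, slice K κ ψ = slice K κ φ) : ψ = φ := by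
  funext J
  have := congrFun (h (J 0)) (Fin.tail J)
  rwa [slice_apply, slice_apply, Fin.cons_self_tail] at this

/-- A row of the monodromy matrix with entries `t`, multiplied on the right by the matrices
`R(y, x_{a-1}) ⋯ R(y, x_0)` restricted to the odd indices; it acts on states of `a` auxiliary spaces
with values in `M`. -/
def dressed (c y : K) (t : Fin 2 → Module.End K M) :
    {a : ℕ} → (Fin a → K) → Fin 2 → Module.End K ((Fin a → Fin 2) → M)
  | 0, _, j => (t j).compLeft (Fin 0 → Fin 2)
  | _ + 1, x, j => LinearMap.pi fun J => LinearMap.proj (Fin.tail J) ∘ₗ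
      (dressed c y t (Fin.tail x) j ∘ₗ slice K (J 0) -
        if J 0 = j then g c y (x 0) • ∑ κ, dressed c y t (Fin.tail x) κ ∘ₗ slice K κ else 0)

theorem slice_dressed (c y : K) (t : Fin 2 → Module.End K M) {a : ℕ} (x : Fin (a + 1) → K)
    (j κ : Fin 2) (ψ : (Fin (a + 1) → Fin 2) → M) :
    slice K κ (dressed c y t x j ψ) =
      dressed c y t (Fin.tail x) j (slice K κ ψ) -
        if κ = j then g c y (x 0) • ∑ m, dressed c y t (Fin.tail x) m (slice K m ψ) else 0 := by
  funext J
  rw [slice_apply, dressed]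
  split_ifs with h <;> simp [h]

/-- Multiplication by R-matrices acting in one more space preserves the RTT relation, a consequence
of the Yang–Baxter equation. With only two columns, it can be checked directly, one auxiliary space
at a time. -/
theorem RowExchange.dressed [CharZero K] {c : K} {z : S → K} {D : Set S}
    {t : S → Fin 2 → Module.End K M} (ht : RowExchange c z D t) (hz : Set.InjOn z D) {a : ℕ}
    (x : Fin a → K) (hx : ∀ s ∈ D, ∀ k, z s ≠ x k) :
    RowExchange c z D fun s => dressed c (z s) (t s) x := by
  induction a with
  | zero =>
    intro r hr s hs hrs j l ψ
    funext J
    exact ht r hr s hs hrs j l (ψ J)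
  | succ a ih =>
    specialize ih (Fin.tail x) fun s hs k => hx s hs k.succ
    intro r hr s hs hrs j l ψ
    refine slice_ext (K := K) fun κ => ?_
    have hzr := sub_ne_zero.2 (hx r hr 0)
    have hzs := sub_ne_zero.2 (hx s hs 0)
    have hzrs := sub_ne_zero.2 (hz.ne hr hs hrs)
    have hzsr := sub_ne_zero.2 (hz.ne hs hr hrs.symm)
    -- These relations bring every word to normal order: column 1 to the left of column 0, and for
    -- equal columns the parameter `s` to the left of `r`. What remains in each case of `j`, `l`,
    -- `κ` is a comparison of rational coefficients.
    have e₁ := fun φ => ih.diag hr hs hrs 1 φ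
    have e₀ := fun φ => ih.diag hr hs hrs 0 φ
    have e₂ := fun φ => ih.zero_one hr hs hrs φ
    have e₃ := fun φ => ih.zero_one hs hr hrs.symm φ
    simp only [map_sub, map_smul, slice_dressed, Fin.sum_univ_two]
    revert κ j l
    simp only [Fin.forall_fin_two, reduceIte, Fin.zero_eq_one_iff, Fin.one_eq_zero_iff,
      OfNat.ofNat_ne_one, sub_zero, map_smul, map_add, map_zero, e₀, e₁, e₂, e₃]
    refine ⟨⟨⟨?_, ?_⟩, ?_, ?_⟩, ⟨?_, ?_⟩, ?_, ?_⟩ <;> match_scalars <;>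
      (simp only [f, g]; field_simp) <;> ring

theorem slice_zero_single {a : ℕ} (ω : M) :
    slice K 0 (Pi.single (0 : Fin (a + 1) → Fin 2) ω) = Pi.single (0 : Fin a → Fin 2) ω := by
  funext J
  have : (Fin.cons 0 J : Fin (a + 1) → Fin 2) = 0 ↔ J = 0 := by
    simp [funext_iff, Fin.forall_fin_succ]
  simp only [slice_apply, Pi.single_apply, this]

theorem slice_one_single {a : ℕ} (ω : M) :
    slice K 1 (Pi.single (0 : Fin (a + 1) → Fin 2) ω) = 0 := by
  funext J
  have : (Fin.cons 1 J : Fin (a + 1) → Fin 2) ≠ 0 := fun h => by simpa using congrFun h 0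
  rw [slice_apply, Pi.single_eq_of_ne this, Pi.zero_apply]

/-- The reference state has no component with first index 3, so each R-matrix only multiplies the
eigenvalue by `1 - g(y,x_k) = f(x_k,y)`. This is the source of the factor `f(ū_1,v_j)` in the
recursion. -/
theorem dressed_zero_single {c y : K} {t : Fin 2 → Module.End K M} {ω : M} {α : K}
    (hω : t 0 ω = α • ω) {a : ℕ} (x : Fin a → K) :
    dressed c y t x 0 (Pi.single 0 ω) = (α * ∏ k, f c (x k) y) • Pi.single 0 ω := by
  induction a with
  | zero =>
    funext J
    simp [dressed, Subsingleton.elim J 0, hω]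
  | succ a ih =>
    refine slice_ext (K := K) fun κ => ?_
    rw [slice_dressed, map_smul, Fin.sum_univ_two, slice_zero_single, slice_one_single,
      ih (Fin.tail x), Fin.prod_univ_succ, f_swap c y (x 0)]
    revert κ
    simp only [Fin.forall_fin_two, slice_zero_single, slice_one_single, ih (Fin.tail x), reduceIte,
      Fin.one_eq_zero_iff, OfNat.ofNat_ne_one, map_zero, smul_zero, sub_zero, add_zero, and_true]
    simp only [Fin.tail]
    module

/-- The vector of states of the auxiliary spaces of `u` from which the Bethe vector is made. -/
def dressedCreation (c : K) (z : S → K) (t : S → Fin 2 → Module.End K M) (ω : M) {a b : ℕ}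
    (x : Fin a → K) (v : Fin b → S) : (Fin a → Fin 2) → M :=
  creation (fun s => dressed c (z s) (t s) x 1) (Pi.single 0 ω) v

variable (c : K) (z : S → K) (t : S → Fin 2 → Module.End K M) (ω : M)

/-- The flip term in the column of `B` only produces the index 3, so the component with index 2 does
not see the first space. -/
theorem slice_zero_dressedCreation {a b : ℕ} (x : Fin (a + 1) → K) (v : Fin b → S) :
    slice K 0 (dressedCreation c z t ω x v) = dressedCreation c z t ω (Fin.tail x) v := by
  induction b with
  | zero => exact slice_zero_single ω
  | succ b ih =>
    specialize ih (Fin.tail v)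
    rw [dressedCreation] at ih
    rw [dressedCreation, creation_succ, slice_dressed, ih, if_neg zero_ne_one, sub_zero]
    rfl

/-- Either the first index was already 3, with total coefficient `1 - g(v_0,x_0) = f(x_0,v_0)`, or
the flip turns 2 into 3 and replaces `B(v_0)` by `A(v_0)`, with coefficient `g(x_0,v_0)`. This is
the recursion defining `insertion`. -/
theorem slice_one_dressedCreation {a b : ℕ} (x : Fin (a + 1) → K) (v : Fin b → S) :
    slice K 1 (dressedCreation c z t ω x v) =
      insertion c z (fun s => dressed c (z s) (t s) (Fin.tail x)) (Pi.single 0 ω) (x 0) v := by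
  induction b with
  | zero => exact slice_one_single ω
  | succ b ih =>
    specialize ih (Fin.tail v)
    have h₀ := slice_zero_dressedCreation c z t ω x (Fin.tail v)
    rw [dressedCreation] at ih h₀
    rw [dressedCreation, creation_succ, slice_dressed, Fin.sum_univ_two, ih, h₀, if_pos rfl,
      insertion, f_swap c (z (v 0)) (x 0), g_swap c (z (v 0)) (x 0), dressedCreation]
    module

theorem slice_one_dressedCreation_eq [CharZero K] {c : K} {z : S → K}
    {t : S → Fin 2 → Module.End K M} {ω : M} {D : Set S} {α : S → K}
    (ht : RowExchange c z D t) (hz : Set.InjOn z D) (hω : ∀ s ∈ D, t s 0 ω = α s • ω) {a b : ℕ}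
    (x : Fin (a + 1) → K) (hx : ∀ s ∈ D, ∀ k, z s ≠ x k) (v : Fin b → S) (hv : ∀ j, v j ∈ D)
    (hinj : Function.Injective v) :
    slice K 1 (dressedCreation c z t ω x v) =
      ∑ j, (α (v j) * g c (x 0) (z (v j)) * (∏ k, f c (Fin.tail x k) (z (v j))) *
          ∏ k, f c (z (v j)) (z (remove v j k))) •
        dressedCreation c z t ω (Fin.tail x) (remove v j) := by
  rw [slice_one_dressedCreation, insertion_eq hz
    (ht.dressed hz (Fin.tail x) fun s hs k => hx s hs k.succ)
    (fun s hs => dressed_zero_single (hω s hs) (Fin.tail x)) (x 0) v hv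
    (fun j => (hx _ (hv j) 0).symm) hinj]
  refine Finset.sum_congr rfl fun j _ => ?_
  rw [mul_right_comm (α (v j))]
  rfl

end Dressing

end SuperYangian
namespace SuperYangian

/-! ### Signs in the graded tensor product. -/

section Matrices

open Matrix

variable {A : Type*} [Ring A] {N : ℕ}

theorem mulVec_single_apply (X : AuxMat N A) (I J : Fin N → Fin 3) (x : A) :
    (X *ᵥ Pi.single J x) I = X I J * x := by
  simp [mulVec, dotProduct, Pi.single_apply]

theorem E_mulVec_single (i j : Fin 3) (p : Fin N) (J : Fin N → Fin 3) (x : A) :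
    E i j p *ᵥ Pi.single J x =
      if J p = j then
        Pi.single (Function.update J p i) ((-1) ^ ((gr i + gr j) * ∑ q ∈ Finset.Iio p, gr (J q)) * x)
      else 0 := by
  funext I
  rw [mulVec_single_apply, E, of_apply]
  split_ifs with h₁ h₂ h₂
  · rw [h₁.2, Pi.single_eq_same]
  · exact absurd h₁.1 h₂
  · rw [Pi.single_eq_of_ne fun h => h₁ ⟨h₂, h⟩, zero_mul]
  · simp

theorem E_mulVec (i j : Fin 3) (p : Fin N) (ψ : (Fin N → Fin 3) → A) (I : Fin N → Fin 3) :
    (E i j p *ᵥ ψ) I =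
      if I p = i then
        (-1) ^ ((gr i + gr j) * ∑ q ∈ Finset.Iio p, gr (I q)) * ψ (Function.update I p j)
      else 0 := by
  have key : ∀ L : Fin N → Fin 3, (L p = j ∧ I = Function.update L p i) ↔
      (L = Function.update I p j ∧ I p = i) := by
    refine fun L => ⟨?_, ?_⟩
    · rintro ⟨h, rfl⟩
      simp [← h]
    · rintro ⟨rfl, h⟩
      simp [← h]
  simp only [mulVec, dotProduct, E, of_apply, key]
  simp only [ite_and, ite_mul, zero_mul, Finset.sum_ite_eq', Finset.mem_univ, if_true]
  split_ifs with h
  · congr 3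
    refine Finset.sum_congr rfl fun q hq => ?_
    rw [Function.update_of_ne (Finset.mem_Iio.1 hq).ne]
  · rfl

theorem deg_update (I : Fin N → Fin 3) (p : Fin N) (k : Fin 3) :
    deg (Function.update I p k) =
      ∑ q ∈ Finset.Iio p, gr (I q) + (gr k + ∑ q ∈ Finset.Ioi p, gr (I q)) := by
  have h₁ : deg (Function.update I p k) =
      gr k + ∑ q ∈ Finset.univ.erase p, gr (Function.update I p k q) := by
    rw [deg, ← Finset.add_sum_erase _ _ (Finset.mem_univ p), Function.update_self]
  have h₂ : Finset.univ.erase p = Finset.Iio p ∪ Finset.Ioi p := by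
    ext q
    simp [lt_or_lt_iff_ne]
  have h₃ : Disjoint (Finset.Iio p) (Finset.Ioi p) := by
    rw [Finset.disjoint_left]
    intro q h h'
    exact lt_asymm (Finset.mem_Iio.1 h) (Finset.mem_Ioi.1 h')
  rw [h₁, h₂, Finset.sum_union h₃, add_left_comm]
  congr 1
  · refine Finset.sum_congr rfl fun q hq => ?_
    rw [Function.update_of_ne (Finset.mem_Iio.1 hq).ne]
  · congr 1
    refine Finset.sum_congr rfl fun q hq => ?_
    rw [Function.update_of_ne (Finset.mem_Ioi.1 hq).ne']

/-- The exponent of the sign of `T_{ik}` at the site `p` in the product over the sites. -/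
def siteSign (I : Fin N → Fin 3) (k : Fin 3) (p : Fin N) : ℕ :=
  (gr (I p) + gr k) * (gr k + ∑ q ∈ Finset.Ioi p, gr (I q))

/-- The signs from the factors to the left of `p` occur twice, in `E` and in `incl`, and cancel;
those from `p` and the factors to its right remain. -/
theorem auxT_mulVec (T : Fin 3 → Fin 3 → A) (p : Fin N) (ψ : (Fin N → Fin 3) → A)
    (I : Fin N → Fin 3) :
    (auxT T p *ᵥ ψ) I =
      ∑ k, (-1) ^ siteSign I k p * T (I p) k * ψ (Function.update I p k) := by
  have hsign : ∀ m r s : ℕ, ((-1 : A)) ^ (m * r) * (-1) ^ (m * (r + s)) = (-1) ^ (m * s) := by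
    intro m r s
    rw [← pow_add, show m * r + m * (r + s) = 2 * (m * r) + m * s by ring, pow_add, pow_mul,
      neg_one_sq, one_pow, one_mul]
  simp only [auxT, sum_mulVec, ← mulVec_mulVec, Finset.sum_apply, E_mulVec]
  rw [Finset.sum_comm]
  refine Finset.sum_congr rfl fun k _ => ?_
  rw [Finset.sum_ite_eq, if_pos (Finset.mem_univ _), incl, mulVec_diagonal, deg_update,
    ← mul_assoc, ← mul_assoc, hsign]
  rfl

/-- The sites increase along the list, so the factor at `p` acts after those to its right. Its sign
therefore involves only the final indices `I` there. -/
theorem prod_auxT_mulVec_single (T : Fin N → Fin 3 → Fin 3 → A) (l : List (Fin N))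
    (hl : l.Pairwise (· < ·)) (I J : Fin N → Fin 3) (x : A) :
    ((l.map fun p => auxT (T p) p).prod *ᵥ Pi.single J x) I =
      if ∀ p, p ∉ l → I p = J p then
        (l.map fun p => (-1) ^ siteSign I (J p) p * T p (I p) (J p)).prod * x
      else 0 := by
  induction l generalizing I with
  | nil =>
    have : (∀ p : Fin N, p ∉ [] → I p = J p) ↔ I = J := by simp [funext_iff]
    simp only [this, List.map_nil, List.prod_nil, one_mulVec, Pi.single_apply, one_mul]
  | cons p l ih =>
    rw [List.pairwise_cons] at hl
    have hpl : p ∉ l := fun h => lt_irrefl _ (hl.1 p h)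
    rw [List.map_cons, List.prod_cons, ← mulVec_mulVec, auxT_mulVec]
    have hcond : ∀ k, (∀ q, q ∉ l → Function.update I p k q = J q) ↔
        (k = J p ∧ ∀ q, q ∉ p :: l → I q = J q) := by
      intro k
      constructor
      · intro h
        refine ⟨by simpa using h p hpl, fun q hq => ?_⟩
        rw [List.mem_cons, not_or] at hq
        simpa [hq.1] using h q hq.2
      · rintro ⟨rfl, h⟩ q hq
        by_cases hqp : q = p
        · subst hqp
          simp
        · rw [Function.update_of_ne hqp]
          exact h q (by simp [hqp, hq])
    have hmap : ∀ k, (l.map fun q => (-1) ^ siteSign (Function.update I p k) (J q) q *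
        T q (Function.update I p k q) (J q)) =
        l.map fun q => (-1) ^ siteSign I (J q) q * T q (I q) (J q) := by
      intro k
      refine List.map_congr_left fun q hq => ?_
      have hpq := hl.1 q hq
      have hsum : ∑ r ∈ Finset.Ioi q, gr (Function.update I p k r) =
          ∑ r ∈ Finset.Ioi q, gr (I r) :=
        Finset.sum_congr rfl fun r hr => by
          rw [Function.update_of_ne (hpq.trans (Finset.mem_Ioi.1 hr)).ne']
      rw [siteSign, siteSign, hsum, Function.update_of_ne hpq.ne']
    simp only [ih hl.2, hcond, hmap, ite_and, mul_ite, mul_zero, Finset.sum_ite_eq',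
      Finset.mem_univ, if_true, List.map_cons, List.prod_cons, mul_assoc]

/-- The sign at `p` involves only the sites to its left, which the factors that have already acted
have not changed. -/
theorem prod_E_mulVec_single (i j : Fin N → Fin 3) (l : List (Fin N)) (hl : l.Pairwise (· < ·))
    (J : Fin N → Fin 3) (x : A) :
    ((l.map fun p => E (i p) (j p) p).prod *ᵥ Pi.single J x) =
      if ∀ p ∈ l, J p = j p then
        Pi.single (fun p => if p ∈ l then i p else J p)
          ((l.map fun p => (-1) ^ ((gr (i p) + gr (j p)) * ∑ q ∈ Finset.Iio p, gr (J q))).prod * x)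
      else 0 := by
  induction l with
  | nil => simp [-mulVec_single]
  | cons p l ih =>
    rw [List.pairwise_cons] at hl
    have hpl : p ∉ l := fun h => lt_irrefl _ (hl.1 p h)
    rw [List.map_cons, List.prod_cons, ← mulVec_mulVec, ih hl.2]
    by_cases h : ∀ q ∈ l, J q = j q
    · have hupd : Function.update (fun q => if q ∈ l then i q else J q) p (i p) =
          fun q => if q ∈ p :: l then i q else J q := by
        funext q
        by_cases hq : q = p
        · subst hq
          simp
        · simp [hq]
      have hsum : ∑ q ∈ Finset.Iio p, gr (if q ∈ l then i q else J q) =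
          ∑ q ∈ Finset.Iio p, gr (J q) :=
        Finset.sum_congr rfl fun q hq => by
          rw [if_neg fun h => lt_asymm (hl.1 q h) (Finset.mem_Iio.1 hq)]
      have hcond : (∀ q ∈ p :: l, J q = j q) ↔ J p = j p := by
        simp only [List.forall_mem_cons]
        exact and_iff_left h
      rw [if_pos h, E_mulVec_single, hupd, hsum, if_neg hpl]
      simp only [hcond, List.map_cons, List.prod_cons, mul_assoc]
    · rw [if_neg h, mulVec_zero, if_neg]
      exact fun h' => h fun q hq => h' q (List.mem_cons_of_mem p hq)

end Matrices

end SuperYangian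
namespace SuperYangian

/-! ### R-matrices on vectors with odd indices. -/

section OddSector

open Matrix

variable {K A : Type*} [Field K] [Ring A] [Algebra K A] {N : ℕ}

/-- The word of odd indices `1, 2` given by a word of `0, 1`. -/
def oddWord (J : Fin N → Fin 2) : Fin N → Fin 3 := fun p => (J p).succ

theorem gr_succ (i : Fin 2) : gr i.succ = 1 := by
  fin_cases i <;> rfl

theorem oddWord_update (J : Fin N → Fin 2) (p : Fin N) (i : Fin 2) :
    Function.update (oddWord J) p i.succ = oddWord (Function.update J p i) := by
  funext q
  by_cases h : q = p
  · subst h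
    simp [oddWord]
  · simp [oddWord, h]

/-- The elementary matrices between odd indices are even, so only the sign `(-1)^{[j]} = -1` in the
definition of the permutation survives. -/
theorem perm_mulVec_single {p q : Fin N} (hpq : p ≠ q) (J : Fin N → Fin 2) (x : A) :
    perm p q *ᵥ Pi.single (oddWord J) x =
      -Pi.single (oddWord (J ∘ Equiv.swap p q)) x := by
  have hswap : Function.update (Function.update J q (J p)) p (J q) = J ∘ Equiv.swap p q := by
    funext r
    by_cases h₁ : r = p
    · subst h₁
      simp
    · by_cases h₂ : r = q
      · subst h₂
        simp [h₁]
      · simp [h₁, h₂, Equiv.swap_apply_of_ne_of_ne]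
  have hsmul : ∀ (n : ℕ) (X : AuxMat N A) (φ : (Fin N → Fin 3) → A),
      ((-1) ^ n * X) *ᵥ φ = (-1 : ℤ) ^ n • (X *ᵥ φ) := by
    intro n X φ
    rcases Nat.even_or_odd n with h | h <;> simp [h.neg_one_pow, neg_mulVec]
  have hterm : ∀ i j : Fin 3, ((-1) ^ gr j * (E i j p * E j i q)) *ᵥ Pi.single (oddWord J) x =
      if j = (J p).succ then if i = (J q).succ then
        -Pi.single (oddWord (J ∘ Equiv.swap p q)) x else 0 else 0 := by
    intro i j
    rw [hsmul, ← mulVec_mulVec, E_mulVec_single]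
    by_cases hi : i = (J q).succ
    · subst hi
      rw [if_pos (show oddWord J q = (J q).succ from rfl), E_mulVec_single,
        Function.update_of_ne hpq]
      by_cases hj : j = (J p).succ
      · subst hj
        rw [if_pos (show oddWord J p = (J p).succ from rfl), if_pos rfl, if_pos rfl,
          oddWord_update, oddWord_update, hswap]
        simp [gr_succ, pow_mul]
      · rw [if_neg (show ¬oddWord J p = j from Ne.symm hj), if_neg hj, smul_zero]
    · rw [if_neg (show ¬oddWord J q = i from Ne.symm hi), if_neg hi, mulVec_zero, smul_zero,
        ite_self]
  simp only [perm, sum_mulVec, hterm, Finset.sum_ite_eq', Finset.mem_univ,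
    if_true]

variable (A) in
/-- The vector `∑_J ψ_J e_J` over the words `J` of odd indices. -/
def oddLift (ψ : (Fin N → Fin 2) → K) : (Fin N → Fin 3) → A :=
  ∑ J, Pi.single (oddWord J) (algebraMap K A (ψ J))

/-- The matrix `R_{pq}` on the vectors with odd indices. -/
def oddR (t : K) (p q : Fin N) : Module.End K ((Fin N → Fin 2) → K) :=
  1 - t • LinearMap.funLeft K K fun J => J ∘ Equiv.swap p q

theorem oddR_apply (t : K) (p q : Fin N) (ψ : (Fin N → Fin 2) → K) (J : Fin N → Fin 2) :
    oddR t p q ψ J = ψ J - t * ψ (J ∘ Equiv.swap p q) := rfl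

theorem rMat_mulVec_oddLift (t : K) {p q : Fin N} (hpq : p ≠ q) (ψ : (Fin N → Fin 2) → K) :
    rMat t p q *ᵥ oddLift A ψ = oddLift A (oddR t p q ψ) := by
  have hswap : ∑ J : Fin N → Fin 2,
      Pi.single (oddWord (J ∘ Equiv.swap p q)) (algebraMap K A (ψ J)) =
      ∑ J : Fin N → Fin 2,
        (Pi.single (oddWord J) (algebraMap K A (ψ (J ∘ Equiv.swap p q))) :
          (Fin N → Fin 3) → A) := by
    refine Fintype.sum_equiv ((Equiv.swap p q).arrowCongr (Equiv.refl _)) _ _ fun J => ?_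
    have : (J ∘ Equiv.swap p q) ∘ Equiv.swap p q = J := by
      funext r
      simp
    simp [Equiv.arrowCongr, this]
  have hperm : perm p q *ᵥ oddLift A ψ = -oddLift A fun J => ψ (J ∘ Equiv.swap p q) := by
    rw [oddLift, mulVec_sum, oddLift, ← hswap, ← Finset.sum_neg_distrib]
    exact Finset.sum_congr rfl fun J _ => perm_mulVec_single hpq J _
  rw [rMat, add_mulVec, one_mulVec, smul_mulVec, hperm, oddLift, oddLift, oddLift, smul_neg,
    ← sub_eq_add_neg, Finset.smul_sum, ← Finset.sum_sub_distrib]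
  refine Finset.sum_congr rfl fun J _ => ?_
  rw [oddR_apply, map_sub, Pi.single_sub, map_mul, ← Pi.single_smul, Algebra.smul_def]

theorem prod_mulVec_oddLift {ι : Type*} (l : List ι) (X : ι → AuxMat N A)
    (Y : ι → Module.End K ((Fin N → Fin 2) → K))
    (h : ∀ i ∈ l, ∀ ψ, X i *ᵥ oddLift A ψ = oddLift A (Y i ψ)) (ψ : (Fin N → Fin 2) → K) :
    (l.map X).prod *ᵥ oddLift A ψ = oddLift A ((l.map Y).prod ψ) := by
  induction l with
  | nil => simp
  | cons i l ih =>
    rw [List.map_cons, List.prod_cons, ← mulVec_mulVec,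
      ih fun j hj => h j (List.mem_cons_of_mem i hj), h i List.mem_cons_self, List.map_cons,
      List.prod_cons, Module.End.mul_apply]

/-- The product `R_{a+j,a} ⋯ R_{a+j,1}` on the vectors with odd indices. -/
def oddLine (c : K) {a b : ℕ} (x : Fin a → K) (y : K) (j : Fin b) :
    Module.End K ((Fin (a + b) → Fin 2) → K) :=
  ((List.finRange a).reverse.map fun k =>
    oddR (g c y (x k)) (Fin.natAdd a j) (Fin.castAdd b k)).prod

/-- The product of the `R`-matrices on the vectors with odd indices. -/
def oddBigR (c : K) {a b : ℕ} (x : Fin a → K) (y : Fin b → K) :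
    Module.End K ((Fin (a + b) → Fin 2) → K) :=
  ((List.finRange b).map fun j => oddLine c x (y j) j).prod

theorem natAdd_ne_castAdd {a b : ℕ} (j : Fin b) (k : Fin a) :
    Fin.natAdd a j ≠ Fin.castAdd b k := by
  intro h
  have := congrArg Fin.val h
  simp at this
  omega

theorem bigR_mulVec_oddLift (c : K) {a b : ℕ} (x : Fin a → K) (y : Fin b → K)
    (ψ : (Fin (a + b) → Fin 2) → K) :
    bigR A c x y *ᵥ oddLift A ψ = oddLift A (oddBigR c x y ψ) :=
  prod_mulVec_oddLift _ _ _ (fun j _ => prod_mulVec_oddLift _ _ _ fun k _ =>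
    rMat_mulVec_oddLift _ (natAdd_ne_castAdd j k)) ψ

end OddSector

/-! ### Ordering of the auxiliary sites. -/

section Sites

variable {K A : Type*} [Field K] [Ring A] [Algebra K A]

/-- The sites of the auxiliary spaces in their order. -/
def sites (a b : ℕ) : List (Fin (a + b)) :=
  (List.finRange a).map (Fin.castAdd b) ++ (List.finRange b).map (Fin.natAdd a)

theorem pairwise_sites (a b : ℕ) : (sites a b).Pairwise (· < ·) := by
  rw [sites, List.pairwise_append]
  refine ⟨?_, ?_, ?_⟩
  · exact List.pairwise_map.2 ((List.pairwise_lt_finRange a).imp fun h => h)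
  · exact List.pairwise_map.2 ((List.pairwise_lt_finRange b).imp fun h => by simpa using h)
  · intro p hp q hq
    obtain ⟨k, -, rfl⟩ := List.mem_map.1 hp
    obtain ⟨j, -, rfl⟩ := List.mem_map.1 hq
    rw [Fin.lt_def, Fin.val_castAdd, Fin.val_natAdd]
    omega

theorem mem_sites {a b : ℕ} (p : Fin (a + b)) : p ∈ sites a b := by
  refine Fin.addCases (fun k => ?_) (fun j => ?_) p <;> simp [sites]

theorem prod_map_sites {B : Type*} [Monoid B] {a b : ℕ} (F : Fin (a + b) → B) :
    ((sites a b).map F).prod =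
      ((List.finRange a).map fun k => F (Fin.castAdd b k)).prod *
        ((List.finRange b).map fun j => F (Fin.natAdd a j)).prod := by
  rw [sites, List.map_append, List.prod_append, List.map_map, List.map_map]
  rfl

theorem prod_map_neg_one_pow_mul {ι : Type*} (l : List ι) (n : ℕ) (F : ι → A) :
    (l.map fun i => (-1) ^ n * F i).prod = (-1) ^ (n * l.length) * (l.map F).prod := by
  induction l with
  | nil => simp
  | cons i l ih =>
    rw [List.map_cons, List.prod_cons, ih, List.map_cons, List.prod_cons, List.length_cons,
      Nat.mul_succ, pow_add, ← mul_assoc, ← mul_assoc, mul_assoc _ (F i),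
      ((Commute.neg_one_right (F i)).pow_right (n * l.length)).eq, ← mul_assoc,
      ((Commute.refl (-1 : A)).pow_pow n (n * l.length)).eq]

end Sites

end SuperYangian
namespace SuperYangian

/-! ### From products of R-matrices to dressed creation operators. -/

theorem prod_map_intertwine {K V W ι : Type*} [Field K] [AddCommGroup V] [Module K V]
    [AddCommGroup W] [Module K W] (φ : V → W) (l : List ι) (X : ι → Module.End K W)
    (Y : ι → Module.End K V) (h : ∀ i ∈ l, ∀ ψ, X i (φ ψ) = φ (Y i ψ)) (ψ : V) :
    (l.map X).prod (φ ψ) = φ ((l.map Y).prod ψ) := by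
  induction l with
  | nil => rfl
  | cons i l ih =>
    rw [List.map_cons, List.prod_cons, Module.End.mul_apply,
      ih fun j hj => h j (List.mem_cons_of_mem i hj), h i List.mem_cons_self, List.map_cons,
      List.prod_cons, Module.End.mul_apply]

section Line

variable {K : Type*} [Field K]

/-- The matrix `R_{0,k}`, with the index of the space `0` as the last argument. -/
def lineR (t : K) {a : ℕ} (k : Fin a) : Module.End K ((Fin a → Fin 2) → Fin 2 → K) where
  toFun G J s := G J s - t * G (Function.update J k s) (J k)
  map_add' G H := by
    funext J s
    simp only [Pi.add_apply]
    ring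
  map_smul' r G := by
    funext J s
    simp only [Pi.smul_apply, smul_eq_mul, RingHom.id_apply]
    ring

theorem lineR_apply (t : K) {a : ℕ} (k : Fin a) (G : (Fin a → Fin 2) → Fin 2 → K)
    (J : Fin a → Fin 2) (s : Fin 2) :
    lineR t k G J s = G J s - t * G (Function.update J k s) (J k) := rfl

/-- The product `R_{0,a} ⋯ R_{0,1}`, with the index of the space `0` as the last argument. -/
def line (c : K) {a : ℕ} (x : Fin a → K) (y : K) :
    Module.End K ((Fin a → Fin 2) → Fin 2 → K) :=
  ((List.finRange a).reverse.map fun k => lineR (g c y (x k)) k).prod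

theorem oddLine_apply_append (c : K) {a b : ℕ} (x : Fin a → K) (y : K) (s : Fin b → Fin 2)
    (ψ : (Fin (a + (b + 1)) → Fin 2) → K) (J : Fin a → Fin 2) (s₀ : Fin 2) :
    oddLine c x y (0 : Fin (b + 1)) ψ (Fin.append J (Fin.cons s₀ s)) =
      line c x y (fun J s₀ => ψ (Fin.append J (Fin.cons s₀ s))) J s₀ := by
  refine (congrFun (congrFun (prod_map_intertwine
    (fun (ψ : (Fin (a + (b + 1)) → Fin 2) → K) (J : Fin a → Fin 2) (s₀ : Fin 2) =>
      ψ (Fin.append J (Fin.cons s₀ s))) _ _ _ (fun k _ ψ => ?_) ψ) J) s₀).symm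
  funext J s₀
  rw [lineR_apply, oddR_apply]
  congr 3
  funext p
  refine Fin.addCases (fun l => ?_) (fun j => ?_) p
  · rw [Function.comp_apply, Fin.append_left]
    by_cases h : l = k
    · subst h
      rw [Equiv.swap_apply_right, Function.update_self, Fin.append_right, Fin.cons_zero]
    · rw [Equiv.swap_apply_of_ne_of_ne (natAdd_ne_castAdd _ _).symm
        (fun h' => h (Fin.castAdd_injective _ _ h')), Function.update_of_ne h, Fin.append_left]
  · rw [Function.comp_apply, Fin.append_right]
    refine Fin.cases ?_ (fun j => ?_) j
    · rw [Equiv.swap_apply_left, Fin.append_left, Fin.cons_zero]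
    · rw [Equiv.swap_apply_of_ne_of_ne
        (fun h => Fin.succ_ne_zero j (Fin.natAdd_injective _ _ h)) (natAdd_ne_castAdd _ _),
        Fin.append_right, Fin.cons_succ, Fin.cons_succ]

/-- The factor `R_{0,1}` is rightmost, so it acts first; the others do not touch the first auxiliary
space. -/
theorem line_apply_cons (c : K) {a : ℕ} (x : Fin (a + 1) → K) (y : K)
    (G : (Fin (a + 1) → Fin 2) → Fin 2 → K) (κ : Fin 2) (J : Fin a → Fin 2) (s : Fin 2) :
    line c x y G (Fin.cons κ J) s =
      line c (Fin.tail x) y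
        (fun J s => G (Fin.cons κ J) s - g c y (x 0) * G (Fin.cons s J) κ) J s := by
  have h₀ : (fun J s => G (Fin.cons κ J) s - g c y (x 0) * G (Fin.cons s J) κ) =
      fun J s => lineR (g c y (x 0)) 0 G (Fin.cons κ J) s := by
    funext J s
    rw [lineR_apply, Fin.update_cons_zero, Fin.cons_zero]
  rw [h₀, line, List.finRange_succ, List.reverse_cons, List.map_append, List.prod_append,
    ← List.map_reverse, List.map_map, List.map_singleton, List.prod_singleton,
    Module.End.mul_apply]
  refine (congrFun (congrFun (prod_map_intertwine
    (fun (ψ : (Fin (a + 1) → Fin 2) → Fin 2 → K) (J : Fin a → Fin 2) (s : Fin 2) =>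
      ψ (Fin.cons κ J) s) _ _ _ (fun k _ ψ => ?_) (lineR (g c y (x 0)) 0 G)) J) s).symm
  funext J s
  rw [lineR_apply, Function.comp_apply, lineR_apply, Fin.cons_update, Fin.cons_succ]
  rfl

variable {M : Type*} [AddCommGroup M] [Module K M]

/-- A transposition of viewpoint: letting the scalar R-matrices act on the auxiliary vector and then
contracting with the row `t` is the same as first multiplying the row by them. -/
theorem sum_line_smul (c y : K) (t : Fin 2 → Module.End K M) {a : ℕ} (x : Fin a → K)
    (G : (Fin a → Fin 2) → Fin 2 → K) (m : M) (J : Fin a → Fin 2) :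
    ∑ s, line c x y G J s • t s m = ∑ j, dressed c y t x j (fun J => G J j • m) J := by
  induction a with
  | zero =>
    refine Finset.sum_congr rfl fun s _ => ?_
    simp [line, dressed]
  | succ a ih =>
    rw [← Fin.cons_self_tail J]
    generalize J 0 = κ
    generalize Fin.tail J = J
    simp only [line_apply_cons, ih]
    have hslice : ∀ (κ j : Fin 2) (J : Fin a → Fin 2),
        dressed c y t x j (fun J => G J j • m) (Fin.cons κ J) =
          slice K κ (dressed c y t x j (fun J => G J j • m)) J := fun _ _ _ => rfl
    have hsub : ∀ j : Fin 2, (fun J : Fin a → Fin 2 =>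
        (G (Fin.cons κ J) j - g c y (x 0) * G (Fin.cons j J) κ) • m) =
        slice K κ (fun J => G J j • m) - g c y (x 0) • slice K j (fun J => G J κ • m) := by
      intro j
      funext J
      rw [Pi.sub_apply, Pi.smul_apply, slice_apply, slice_apply, sub_smul, mul_smul]
    simp only [hslice, slice_dressed, hsub, map_sub, map_smul]
    rw [← Finset.sum_apply, ← Finset.sum_apply, Finset.sum_sub_distrib, Finset.sum_sub_distrib,
      Finset.sum_ite_eq, if_pos (Finset.mem_univ _), Finset.smul_sum]

end Line

section Link

variable {K M S : Type*} [Field K] [AddCommGroup M] [Module K M]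

/-- The vector `ψ ⊗ e_2` with the last factor put in the first space after the `a`-th. -/
def insertOne {a b : ℕ} (ψ : (Fin (a + b) → Fin 2) → K) (J : Fin (a + (b + 1)) → Fin 2) : K :=
  if J (Fin.natAdd a 0) = 1 then
    ψ (Fin.append (fun k => J (Fin.castAdd (b + 1) k)) fun j => J (Fin.natAdd a j.succ))
  else 0

theorem insertOne_append {a b : ℕ} (ψ : (Fin (a + b) → Fin 2) → K) (J : Fin a → Fin 2)
    (s₀ : Fin 2) (s : Fin b → Fin 2) :
    insertOne ψ (Fin.append J (Fin.cons s₀ s)) = if s₀ = 1 then ψ (Fin.append J s) else 0 := by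
  simp only [insertOne, Fin.append_left, Fin.append_right, Fin.cons_zero, Fin.cons_succ]

theorem oddR_insertOne (t : K) {a b : ℕ} (j : Fin b) (k : Fin a)
    (ψ : (Fin (a + b) → Fin 2) → K) :
    oddR t (Fin.natAdd a j.succ) (Fin.castAdd (b + 1) k) (insertOne ψ) =
      insertOne (oddR t (Fin.natAdd a j) (Fin.castAdd b k) ψ) := by
  funext J
  have h₁ : Equiv.swap (Fin.natAdd a j.succ) (Fin.castAdd (b + 1) k) (Fin.natAdd a 0) =
      Fin.natAdd a 0 :=
    Equiv.swap_apply_of_ne_of_ne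
      (fun h => Fin.succ_ne_zero j (Fin.natAdd_injective _ _ h).symm) (natAdd_ne_castAdd _ _)
  have h₂ : (Fin.append (fun l => (J ∘ Equiv.swap (Fin.natAdd a j.succ) (Fin.castAdd (b + 1) k))
        (Fin.castAdd (b + 1) l)) fun i =>
        (J ∘ Equiv.swap (Fin.natAdd a j.succ) (Fin.castAdd (b + 1) k)) (Fin.natAdd a i.succ)) =
      (Fin.append (fun k => J (Fin.castAdd (b + 1) k)) fun j => J (Fin.natAdd a j.succ)) ∘
        Equiv.swap (Fin.natAdd a j) (Fin.castAdd b k) := by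
    funext p
    refine Fin.addCases (fun l => ?_) (fun i => ?_) p
    · rw [Fin.append_left, Function.comp_apply, Function.comp_apply]
      by_cases h : l = k
      · subst h
        rw [Equiv.swap_apply_right, Equiv.swap_apply_right, Fin.append_right]
      · rw [Equiv.swap_apply_of_ne_of_ne (natAdd_ne_castAdd _ _).symm
          (fun h' => h (Fin.castAdd_injective _ _ h')),
          Equiv.swap_apply_of_ne_of_ne (natAdd_ne_castAdd _ _).symm
          (fun h' => h (Fin.castAdd_injective _ _ h')), Fin.append_left]
    · rw [Fin.append_right, Function.comp_apply, Function.comp_apply]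
      by_cases h : i = j
      · subst h
        rw [Equiv.swap_apply_left, Equiv.swap_apply_left, Fin.append_left]
      · rw [Equiv.swap_apply_of_ne_of_ne
          (fun h' => h (Fin.succ_injective _ (Fin.natAdd_injective _ _ h')))
          (natAdd_ne_castAdd _ _),
          Equiv.swap_apply_of_ne_of_ne (fun h' => h (Fin.natAdd_injective _ _ h'))
          (natAdd_ne_castAdd _ _), Fin.append_right]
  rw [oddR_apply, insertOne, insertOne, insertOne, Function.comp_apply, h₁, h₂, oddR_apply]
  split_ifs
  · rfl
  · rw [mul_zero, sub_zero]

theorem insertOne_single (a b : ℕ) :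
    insertOne (Pi.single (Fin.append (0 : Fin a → Fin 2) (1 : Fin b → Fin 2)) (1 : K)) =
      Pi.single (Fin.append 0 1) 1 := by
  funext J
  have hJ : J = Fin.append (0 : Fin a → Fin 2) (1 : Fin (b + 1) → Fin 2) ↔
      J (Fin.natAdd a 0) = 1 ∧
        (Fin.append (fun k => J (Fin.castAdd (b + 1) k)) fun j => J (Fin.natAdd a j.succ)) =
          Fin.append (0 : Fin a → Fin 2) (1 : Fin b → Fin 2) := by
    constructor
    · rintro rfl
      simp
      rfl
    · rintro ⟨h₀, h⟩
      funext p
      refine Fin.addCases (fun l => ?_) (fun i => ?_) p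
      · simpa using congrFun h (Fin.castAdd b l)
      · refine Fin.cases ?_ (fun i => ?_) i
        · simpa using h₀
        · simpa using congrFun h (Fin.natAdd a i)
  rw [insertOne, Pi.single_apply, Pi.single_apply, ← ite_and]
  simp only [hJ]

/-- The lines of `v_2, …, v_b` act trivially on the space of `v_1`, whose vector stays `e_3` until
the leftmost line acts. -/
theorem oddBigR_succ (c : K) {a b : ℕ} (x : Fin a → K) (y : Fin (b + 1) → K) :
    oddBigR c x y (Pi.single (Fin.append 0 1) 1) =
      oddLine c x (y 0) 0 (insertOne (oddBigR c x (Fin.tail y) (Pi.single (Fin.append 0 1) 1))) := by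
  rw [oddBigR, List.finRange_succ, List.map_cons, List.prod_cons, List.map_map,
    Module.End.mul_apply, ← insertOne_single, oddBigR]
  congr 1
  exact prod_map_intertwine insertOne _ _ _ (fun j _ ψ =>
    prod_map_intertwine insertOne _ _ _ (fun k _ ψ => oddR_insertOne _ j k ψ) ψ) _

theorem sum_cons {X : Type*} [AddCommMonoid X] {b : ℕ} (F : (Fin (b + 1) → Fin 2) → X) :
    ∑ s, F s = ∑ s₀, ∑ s, F (Fin.cons s₀ s) := by
  rw [← Fintype.sum_prod_type']
  exact (Fintype.sum_equiv (Fin.consEquiv fun _ => Fin 2) _ _ fun _ => rfl).symm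

theorem sum_append {X : Type*} [AddCommMonoid X] {a b : ℕ} (F : (Fin (a + b) → Fin 2) → X) :
    ∑ J, F J = ∑ J, ∑ s, F (Fin.append J s) := by
  rw [← Fintype.sum_prod_type']
  exact (Fintype.sum_equiv (Fin.appendEquiv a b) _ _ fun _ => rfl).symm

theorem sum_oddBigR_smul (c : K) (z : S → K) (t : S → Fin 2 → Module.End K M) (ω : M) {a b : ℕ}
    (x : Fin a → K) (v : Fin b → S) (J : Fin a → Fin 2) :
    ∑ s : Fin b → Fin 2, oddBigR c x (fun j => z (v j)) (Pi.single (Fin.append 0 1) 1)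
        (Fin.append J s) • ((List.finRange b).map fun j => t (v j) (s j)).prod ω =
      dressedCreation c z t ω x v J := by
  induction b generalizing J with
  | zero =>
    have h : ∀ s : Fin 0 → Fin 2, (Fin.append J s = Fin.append 0 1) ↔ J = 0 := by
      intro s
      refine ⟨fun h => ?_, ?_⟩
      · funext k
        have := congrFun h (Fin.castAdd 0 k)
        rwa [Fin.append_left, Fin.append_left] at this
      · rintro rfl
        rw [Subsingleton.elim s 1]
    simp [oddBigR, dressedCreation, creation, Pi.single_apply, h]
  | succ b ih =>
    have hP : ∀ (s₀ : Fin 2) (s : Fin b → Fin 2),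
        ((List.finRange (b + 1)).map fun j =>
          t (v j) ((Fin.cons s₀ s : Fin (b + 1) → Fin 2) j)).prod ω =
        t (v 0) s₀ (((List.finRange b).map fun j => t (Fin.tail v j) (s j)).prod ω) := by
      intro s₀ s
      rw [List.finRange_succ, List.map_cons, List.prod_cons, List.map_map]
      rfl
    rw [sum_cons, Finset.sum_comm, oddBigR_succ]
    simp only [hP, oddLine_apply_append, sum_line_smul]
    -- The space of the first `v` carries `e_3`, so of the two dressed entries only `B` contributes.
    simp only [insertOne_append, Fin.sum_univ_two, zero_ne_one, if_false, if_true, zero_smul]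
    have hzero : dressed c (z (v 0)) (t (v 0)) x 0 (fun _ => (0 : M)) = 0 := map_zero _
    simp only [hzero, Pi.zero_apply, zero_add]
    rw [← Finset.sum_apply, ← map_sum, dressedCreation, creation_succ]
    refine congrFun (congrArg _ (funext fun J => ?_)) J
    rw [Finset.sum_apply]
    exact ih (Fin.tail v) J

end Link

end SuperYangian
namespace SuperYangian

open Matrix

/-! ### Evaluation of the super-trace. -/

section Trace

variable {A : Type*} [Ring A]

theorem prod_map_one_of_forall {ι : Type*} (l : List ι) (F : ι → A) (h : ∀ i ∈ l, F i = 1) :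
    (l.map F).prod = 1 := by
  rw [List.map_congr_left h, List.map_const', List.prod_replicate, one_pow]

/-- The word `1^a 2^b`. -/
def rowWord (a b : ℕ) : Fin (a + b) → Fin 3 := Fin.append (fun _ => 0) fun _ => 1

theorem rowWord_castAdd {a b : ℕ} (k : Fin a) : rowWord a b (Fin.castAdd b k) = 0 :=
  Fin.append_left _ _ k

theorem rowWord_natAdd {a b : ℕ} (j : Fin b) : rowWord a b (Fin.natAdd a j) = 1 :=
  Fin.append_right _ _ j

theorem deg_rowWord (a b : ℕ) : deg (rowWord a b) = b := by
  simp [deg, Fin.sum_univ_add, rowWord_castAdd, rowWord_natAdd, gr]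

theorem sum_Iio_rowWord {a b : ℕ} (k : Fin a) :
    ∑ q ∈ Finset.Iio (Fin.castAdd b k), gr (rowWord a b q) = 0 := by
  refine Finset.sum_eq_zero fun q hq => ?_
  have hq' : (q : ℕ) < a := (Fin.lt_def.1 (Finset.mem_Iio.1 hq)).trans k.2
  rw [show q = Fin.castAdd b ⟨q, hq'⟩ from rfl, rowWord_castAdd]
  rfl

theorem sum_Ioi_rowWord {a b : ℕ} (k : Fin a) :
    ∑ q ∈ Finset.Ioi (Fin.castAdd b k), gr (rowWord a b q) = b := by
  have h := deg_update (rowWord a b) (Fin.castAdd b k) 0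
  rw [sum_Iio_rowWord, ← rowWord_castAdd (b := b) k, Function.update_eq_self, deg_rowWord,
    rowWord_castAdd, zero_add] at h
  exact (h.trans (Nat.zero_add _)).symm

theorem prod_E_mulVec_single_one {a b : ℕ} (J : Fin (a + b) → Fin 3) :
    (((List.finRange a).map fun k => E (A := A) 1 0 (Fin.castAdd b k)).prod *
        ((List.finRange b).map fun j => E 2 1 (Fin.natAdd a j)).prod) *ᵥ Pi.single J 1 =
      if J = rowWord a b then Pi.single (oddWord (Fin.append 0 1)) 1 else 0 := by
  have h := prod_map_sites (a := a) (b := b) fun p =>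
    E (A := A) (oddWord (Fin.append (0 : Fin a → Fin 2) (1 : Fin b → Fin 2)) p) (rowWord a b p) p
  simp only [rowWord_castAdd, rowWord_natAdd, oddWord, Fin.append_left, Fin.append_right] at h
  change _ = ((List.finRange a).map fun k => E (A := A) 1 0 (Fin.castAdd b k)).prod *
        ((List.finRange b).map fun j => E 2 1 (Fin.natAdd a j)).prod at h
  rw [← h, prod_E_mulVec_single _ _ _ (pairwise_sites a b)]
  simp only [mem_sites, if_true, forall_const, ← funext_iff]
  split_ifs with hJ
  · subst hJ
    rw [prod_map_one_of_forall, one_mul]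
    · rfl
    · intro p _
      refine Fin.addCases (fun k => ?_) (fun j => ?_) p
      · rw [sum_Iio_rowWord, mul_zero, pow_zero]
      · rw [Fin.append_right, rowWord_natAdd, pow_mul]
        simp [gr]
  · rfl

variable {K : Type*} [Field K] [Algebra K A]

/-- Each of the `a` odd entries `T_{1,J_k}` has site sign `(-1)^{b+1}`; the entries in row 2 are
even and give none. -/
theorem prod_auxT_mulVec_oddLift {S : Type*} (T : S → Fin 3 → Fin 3 → A) {a b : ℕ} (u : Fin a → S)
    (v : Fin b → S) (ψ : (Fin (a + b) → Fin 2) → K) :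
    ((((List.finRange a).map fun k => auxT (T (u k)) (Fin.castAdd b k)).prod *
        ((List.finRange b).map fun j => auxT (T (v j)) (Fin.natAdd a j)).prod) *ᵥ
      oddLift A ψ) (rowWord a b) =
    (-1) ^ ((b + 1) * a) * ∑ J, ∑ s, ψ (Fin.append J s) •
      (((List.finRange a).map fun k => T (u k) 0 (J k).succ).prod *
        ((List.finRange b).map fun j => T (v j) 1 (s j).succ).prod) := by
  have h := prod_map_sites (a := a) (b := b) fun p =>
    auxT (Fin.append (fun k => T (u k)) (fun j => T (v j)) p) p
  simp only [Fin.append_left, Fin.append_right] at h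
  rw [← h, oddLift, mulVec_sum, Finset.sum_apply, sum_append]
  simp only [Finset.mul_sum]
  refine Finset.sum_congr rfl fun J _ => Finset.sum_congr rfl fun s _ => ?_
  rw [prod_auxT_mulVec_single _ _ (pairwise_sites a b), if_pos fun p hp => absurd (mem_sites p) hp,
    prod_map_sites]
  have h₁ : ∀ k : Fin a, ((-1 : A)) ^ siteSign (rowWord a b)
      (oddWord (Fin.append J s) (Fin.castAdd b k)) (Fin.castAdd b k) = (-1) ^ (b + 1) := by
    intro k
    rw [siteSign, sum_Ioi_rowWord, rowWord_castAdd, oddWord, gr_succ, add_comm 1 b]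
    congr 1
    exact one_mul _
  have h₂ : ∀ j : Fin b, ((-1 : A)) ^ siteSign (rowWord a b)
      (oddWord (Fin.append J s) (Fin.natAdd a j)) (Fin.natAdd a j) = 1 := by
    intro j
    rw [siteSign, rowWord_natAdd, oddWord, gr_succ, pow_mul]
    simp [gr]
  simp only [h₁, h₂, one_mul, prod_map_neg_one_pow_mul, List.length_finRange, Fin.append_left,
    Fin.append_right, rowWord_castAdd, rowWord_natAdd]
  simp only [oddWord, Fin.append_left, Fin.append_right]
  rw [Algebra.smul_def, Algebra.commutes, mul_assoc, mul_assoc, mul_assoc]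

theorem betheOp_eq {S : Type*} (c : K) (z : S → K) (T : S → Fin 3 → Fin 3 → A) {a b : ℕ}
    (u : Fin a → S) (v : Fin b → S) :
    betheOp c z T u v = ((-1) ^ b / bigH c fun k => z (u k)) •
      ∑ J, ∑ s, oddBigR c (fun k => z (u k)) (fun j => z (v j)) (Pi.single (Fin.append 0 1) 1)
          (Fin.append J s) •
        (((List.finRange a).map fun k => T (u k) 0 (J k).succ).prod *
          ((List.finRange b).map fun j => T (v j) 1 (s j).succ).prod) := by
  have hsingle : (Pi.single (oddWord (Fin.append (0 : Fin a → Fin 2) (1 : Fin b → Fin 2))) 1 :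
      (Fin (a + b) → Fin 3) → A) = oddLift A (Pi.single (Fin.append 0 1) (1 : K)) := by
    rw [oddLift, Finset.sum_eq_single (Fin.append 0 1)]
    · rw [Pi.single_eq_same, map_one]
    · intro J _ hJ
      rw [Pi.single_eq_of_ne hJ, map_zero, Pi.single_zero]
    · exact fun h => absurd (Finset.mem_univ _) h
  have hdiag : ∀ (X : AuxMat (a + b) A) (J : Fin (a + b) → Fin 3),
      X J J = (X *ᵥ Pi.single J 1) J := fun X J => by rw [mulVec_single_apply, mul_one]
  have hE := prod_E_mulVec_single_one (A := A) (a := a) (b := b)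
  have hT := prod_auxT_mulVec_oddLift (K := K) T u v
  -- These are the trace signs `(-1)^b` and `(-1)^{ab}` and the monodromy sign `(-1)^{(b+1)a}`. With
  -- the prefactor `(-1)^a` of the Bethe vector, `(-1)^b` is left.
  have hsign : ((-1 : K)) ^ b * ((-1) ^ (a * b) * (-1) ^ ((b + 1) * a)) = (-1) ^ a * (-1) ^ b := by
    rw [← pow_add, ← pow_add, ← pow_add,
      show b + (a * b + (b + 1) * a) = 2 * (a * b) + (a + b) by ring, pow_add, pow_mul]
    simp
  have hsmul : ∀ (n : ℕ) (x : A), (-1) ^ n * x = ((-1 : K)) ^ n • x := by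
    intro n x
    rw [Algebra.smul_def, map_pow, map_neg, map_one]
  rw [betheOp, mul_assoc (_ * bigR A c _ _)]
  generalize ((List.finRange a).map fun k => E (A := A) 1 0 (Fin.castAdd b k)).prod *
    ((List.finRange b).map fun j => E 2 1 (Fin.natAdd a j)).prod = X at hE ⊢
  generalize ((List.finRange a).map fun k => auxT (T (u k)) (Fin.castAdd b k)).prod *
    ((List.finRange b).map fun j => auxT (T (v j)) (Fin.natAdd a j)).prod = Z at hT ⊢
  have hterm : ∀ J : Fin (a + b) → Fin 3, (Z * bigR A c (fun k => z (u k)) (fun j => z (v j)) * X)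
      J J = if J = rowWord a b then (Z *ᵥ oddLift A (oddBigR c (fun k => z (u k))
        (fun j => z (v j)) (Pi.single (Fin.append 0 1) 1))) J else 0 := by
    intro J
    refine (hdiag _ J).trans ?_
    rw [← mulVec_mulVec, ← mulVec_mulVec, hE]
    split_ifs with h
    · rw [hsingle, bigR_mulVec_oddLift]
    · simp
  rw [superTrace, Finset.sum_eq_single (rowWord a b), hterm, if_pos rfl, hT, deg_rowWord, hsmul,
    hsmul, hsmul, smul_smul, smul_smul, smul_smul]
  · congr 1
    rw [mul_assoc, mul_assoc, hsign, div_mul_eq_mul_div, ← mul_assoc, ← pow_add, ← two_mul, pow_mul,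
      neg_one_sq, one_pow, one_mul]
  · intro J _ hJ
    rw [hterm, if_neg hJ, mul_zero, mul_zero]
  · exact fun h => absurd (Finset.mem_univ _) h

end Trace

end SuperYangian
namespace SuperYangian

/-! ### The recursion over a field of characteristic zero. -/

section Recursion

variable {K A M S : Type*} [Field K] [Ring A] [Algebra K A] [AddCommGroup M] [Module A M]
  [Module K M] [IsScalarTower K A M]

/-- The entries `T_{21}, T_{22}` (counted from `0`: `T_{11}, T_{12}`) as operators. -/
def rowEnd (K : Type*) {A S : Type*} (M : Type*) [Field K] [Ring A] [Algebra K A]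
    [AddCommGroup M] [Module A M] [Module K M] [IsScalarTower K A M]
    (T : S → Fin 3 → Fin 3 → A) (s : S) (j : Fin 2) : Module.End K M :=
  Algebra.lsmul K K M (T s 1 j.succ)

theorem betheVec_eq (c : K) (z : S → K) (T : S → Fin 3 → Fin 3 → A) (Ω : M) {a b : ℕ}
    (u : Fin a → S) (v : Fin b → S) :
    betheVec c z T Ω u v = ((-1) ^ b / bigH c fun k => z (u k)) •
      ∑ J, ((List.finRange a).map fun k => T (u k) 0 (J k).succ).prod •
        dressedCreation c z (rowEnd K M T) Ω (fun k => z (u k)) v J := by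
  rw [betheVec, betheOp_eq, smul_assoc, Finset.sum_smul]
  congr 1
  refine Finset.sum_congr rfl fun J _ => ?_
  rw [← sum_oddBigR_smul, Finset.sum_smul, Finset.smul_sum]
  refine Finset.sum_congr rfl fun s _ => ?_
  have h : ((List.finRange b).map fun j => rowEnd K M T (v j) (s j)).prod =
      Algebra.lsmul K K M ((List.finRange b).map fun j => T (v j) 1 (s j).succ).prod := by
    rw [map_list_prod, List.map_map]
    rfl
  rw [h, Algebra.lsmul_coe, smul_assoc, mul_smul, smul_algebra_smul_comm]

theorem bigH_succ (c : K) {a : ℕ} (w : Fin (a + 1) → K) :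
    bigH c w = (∏ k : Fin a, h c (w k.succ) (w 0)) * bigH c (Fin.tail w) := by
  have hIio : ∀ {n : ℕ} (j : Fin n) (F : Fin n → K),
      ∏ k ∈ Finset.Iio j, F k = ∏ k, if k < j then F k else 1 := by
    intro n j F
    rw [← Finset.prod_filter]
    congr 1
    ext k
    simp
  have h₁ : ∀ j : Fin a, ∏ k ∈ Finset.Iio j.succ, h c (w j.succ) (w k) =
      h c (w j.succ) (w 0) * ∏ k ∈ Finset.Iio j, h c (w j.succ) (w k.succ) := by
    intro j
    rw [hIio, hIio, Fin.prod_univ_succ, if_pos (Fin.succ_pos j)]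
    simp only [Fin.succ_lt_succ_iff]
  rw [bigH, Fin.prod_univ_succ, hIio]
  simp only [Fin.not_lt_zero, if_false, Finset.prod_const_one, one_mul]
  simp only [h₁]
  rw [Finset.prod_mul_distrib]
  rfl

/-- The sum over words splits by the first letter into the `T_{12}(u_1)` and `T_{13}(u_1)` terms.
The only commutation relations involved are those of `T_{22}` and `T_{23}` at the parameters `v_j`.
-/
theorem betheVec_succ [CharZero K] {c : K} {z : S → K} {T : S → Fin 3 → Fin 3 → A} {Ω : M}
    {lam : S → K} {a b : ℕ} (u : Fin (a + 1) → S) (v : Fin b → S)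
    (hrow : ∀ i j, i ≠ j → ∀ k l : Fin 2,
      T (v i) 1 k.succ * T (v j) 1 l.succ - T (v j) 1 l.succ * T (v i) 1 k.succ =
        g c (z (v i)) (z (v j)) •
          (T (v j) 1 l.succ * T (v i) 1 k.succ - T (v i) 1 l.succ * T (v j) 1 k.succ))
    (hdiag : ∀ j, T (v j) 1 1 • Ω = lam (v j) • Ω)
    (hzv : Function.Injective fun j => z (v j)) (hzu : ∀ k j, z (u k) ≠ z (v j)) :
    betheVec c z T Ω u v =
      (∏ k, h c (z (Fin.tail u k)) (z (u 0)))⁻¹ •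
        (T (u 0) 0 1 • betheVec c z T Ω (Fin.tail u) v) -
      (∏ k, h c (z (Fin.tail u k)) (z (u 0)))⁻¹ •
        ∑ j, (lam (v j) * g c (z (u 0)) (z (v j)) *
            (∏ k, f c (z (Fin.tail u k)) (z (v j))) *
            (∏ k, f c (z (v j)) (z (remove v j k)))) •
          (T (u 0) 0 2 • betheVec c z T Ω (Fin.tail u) (remove v j)) := by
  have ht : RowExchange c z (Set.range v) (rowEnd K M T) := by
    rintro _ ⟨i, rfl⟩ _ ⟨j, rfl⟩ hij k l x
    have h := congrArg (fun y : A => y • x) (hrow i j (fun h => hij (congrArg v h)) k l)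
    simp only [sub_smul, smul_assoc, mul_smul] at h
    exact h
  have hz : Set.InjOn z (Set.range v) := by
    rintro _ ⟨i, rfl⟩ _ ⟨j, rfl⟩ hij
    exact congrArg v (hzv hij)
  have hω : ∀ s ∈ Set.range v, rowEnd K M T s 0 Ω = lam s • Ω := by
    rintro _ ⟨j, rfl⟩
    exact hdiag j
  have hx : ∀ s ∈ Set.range v, ∀ k, z s ≠ z (u k) := by
    rintro _ ⟨j, rfl⟩ k
    exact (hzu k j).symm
  have h₁ := slice_one_dressedCreation_eq ht hz hω (fun k => z (u k)) hx v
    (fun j => ⟨j, rfl⟩) (fun i j hij => hzv (congrArg z hij))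
  have h₀ := slice_zero_dressedCreation c z (rowEnd K M T) Ω (fun k => z (u k)) v
  have hP : ∀ (κ : Fin 2) (J : Fin a → Fin 2) (m : M), ((List.finRange (a + 1)).map fun k =>
      T (u k) 0 (Fin.succ ((Fin.cons κ J : Fin (a + 1) → Fin 2) k))).prod • m =
      T (u 0) 0 κ.succ •
        ((List.finRange a).map fun k => T (Fin.tail u k) 0 (J k).succ).prod • m := by
    intro κ J m
    rw [List.finRange_succ, List.map_cons, List.prod_cons, List.map_map, mul_smul]
    rfl
  -- An index `j` forces `b ≥ 1`, so `b - 1` is a genuine predecessor. Passing from `(-1)^b` to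
  -- `(-1)^{b-1}` gives the minus sign of the second term.
  have hneg : ∀ j : Fin b, ((-1 : K)) ^ b = -(-1) ^ (b - 1) := by
    intro j
    obtain ⟨n, rfl⟩ : ∃ n, b = n + 1 := ⟨b - 1, by have := j.2; omega⟩
    rw [pow_succ, mul_neg_one]
    rfl
  have e₀ : ∑ J : Fin a → Fin 2, T (u 0) 0 (Fin.succ 0) •
      ((List.finRange a).map fun k => T (Fin.tail u k) 0 (J k).succ).prod •
        slice K 0 (dressedCreation c z (rowEnd K M T) Ω (fun k => z (u k)) v) J =
      T (u 0) 0 1 • ∑ J : Fin a → Fin 2,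
        ((List.finRange a).map fun k => T (Fin.tail u k) 0 (J k).succ).prod •
          dressedCreation c z (rowEnd K M T) Ω (fun k => z (Fin.tail u k)) v J := by
    rw [Finset.smul_sum, h₀]
    rfl
  have e₁ : ∑ J : Fin a → Fin 2, T (u 0) 0 (Fin.succ 1) •
      ((List.finRange a).map fun k => T (Fin.tail u k) 0 (J k).succ).prod •
        slice K 1 (dressedCreation c z (rowEnd K M T) Ω (fun k => z (u k)) v) J =
      ∑ j, (lam (v j) * g c (z (u 0)) (z (v j)) *
            (∏ k, f c (z (Fin.tail u k)) (z (v j))) *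
            (∏ k, f c (z (v j)) (z (remove v j k)))) •
        T (u 0) 0 2 • ∑ J : Fin a → Fin 2,
          ((List.finRange a).map fun k => T (Fin.tail u k) 0 (J k).succ).prod •
            dressedCreation c z (rowEnd K M T) Ω (fun k => z (Fin.tail u k)) (remove v j) J := by
    rw [h₁]
    simp only [Finset.smul_sum, Finset.sum_apply, Pi.smul_apply]
    rw [Finset.sum_comm]
    refine Finset.sum_congr rfl fun j _ => Finset.sum_congr rfl fun J _ => ?_
    rw [smul_algebra_smul_comm, smul_algebra_smul_comm]
    rfl
  simp only [betheVec_eq]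
  rw [sum_cons, Fin.sum_univ_two]
  simp only [hP]
  simp only [← slice_apply (K := K)]
  have htail : (Fin.tail fun k => z (u k)) = fun k => z (Fin.tail u k) := rfl
  rw [e₀, e₁, bigH_succ, htail, smul_add, sub_eq_add_neg, smul_algebra_smul_comm, smul_smul]
  congr 1
  · congr 1
    rw [div_eq_mul_inv, div_eq_mul_inv, mul_inv]
    simp only [Fin.tail]
    ring
  · rw [Finset.smul_sum, Finset.smul_sum, ← Finset.sum_neg_distrib]
    refine Finset.sum_congr rfl fun j _ => ?_
    rw [smul_algebra_smul_comm _ (T (u 0) 0 2), smul_smul, smul_smul, smul_smul, ← neg_smul]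
    congr 1
    rw [hneg j, div_eq_mul_inv, div_eq_mul_inv, mul_inv]
    simp only [Fin.tail]
    ring

end Recursion

end SuperYangian
namespace SuperYangian

/-! ### Exchange relations for formal spectral parameters. -/

section Series

variable {B : Type*} {n : ℕ}

/-- The extension of a sequence by zero to the integers. -/
def extendZero [Zero B] (q : ℕ → B) (m : ℤ) : B := if 0 ≤ m then q m.toNat else 0

theorem extendZero_natCast [Zero B] (q : ℕ → B) (m : ℕ) : extendZero q m = q m := by
  simp [extendZero]

theorem extendZero_of_neg [Zero B] (q : ℕ → B) {m : ℤ} (hm : m < 0) : extendZero q m = 0 :=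
  if_neg (not_le.2 hm)

theorem powEmb_apply (s : Fin n) (k : ℕ) : powEmb n s k = toLex (Pi.single s (k : ℤ)) := rfl

theorem coeff_seriesIn [Zero B] (s : Fin n) (q : ℕ → B) (γ : Expo n) :
    (seriesIn n s q).coeff γ =
      if γ = toLex (Pi.single s (ofLex γ s)) then extendZero q (ofLex γ s) else 0 := by
  by_cases hγ : γ ∈ Set.range (powEmb n s)
  · obtain ⟨k, rfl⟩ := hγ
    rw [seriesIn, HahnSeries.embDomain_coeff, powEmb_apply, ofLex_toLex, Pi.single_eq_same,
      if_pos rfl, extendZero_natCast]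
  · rw [seriesIn, HahnSeries.embDomain_of_notMem_range hγ]
    split_ifs with h
    · rcases lt_or_ge (ofLex γ s) 0 with h' | h'
      · rw [extendZero_of_neg q h']
      · refine absurd ⟨(ofLex γ s).toNat, ?_⟩ hγ
        rw [powEmb_apply, Int.toNat_of_nonneg h', ← h]
    · rfl

theorem eq_single_of_coeff_seriesIn_ne_zero [Zero B] {s : Fin n} {q : ℕ → B} {γ : Expo n}
    (h : (seriesIn n s q).coeff γ ≠ 0) : γ = toLex (Pi.single s (ofLex γ s)) := by
  by_contra h'
  exact h (by rw [coeff_seriesIn, if_neg h'])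

theorem ofLex_single_add_single {s t : Fin n} (hst : s ≠ t) (i j : ℤ) :
    ofLex (toLex (Pi.single s i) + toLex (Pi.single t j) : Expo n) s = i ∧
      ofLex (toLex (Pi.single s i) + toLex (Pi.single t j) : Expo n) t = j := by
  constructor
  · change (Pi.single s i : Fin n → ℤ) s + (Pi.single t j : Fin n → ℤ) s = i
    simp [hst]
  · change (Pi.single s i : Fin n → ℤ) t + (Pi.single t j : Fin n → ℤ) t = j
    simp [hst.symm]

/-- As `s ≠ t`, an exponent splits in at most one way into a power of `x_s` and a power of `x_t`, so
the convolution has at most one term. -/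
theorem coeff_seriesIn_mul [Ring B] {s t : Fin n} (hst : s ≠ t) (q r : ℕ → B) (γ : Expo n) :
    (seriesIn n s q * seriesIn n t r).coeff γ =
      if γ = toLex (Pi.single s (ofLex γ s)) + toLex (Pi.single t (ofLex γ t)) then
        extendZero q (ofLex γ s) * extendZero r (ofLex γ t) else 0 := by
  have hval : ∀ p : Expo n × Expo n, (seriesIn n s q).coeff p.1 ≠ 0 →
      (seriesIn n t r).coeff p.2 ≠ 0 → p.1 + p.2 = γ →
      p = (toLex (Pi.single s (ofLex γ s)), toLex (Pi.single t (ofLex γ t))) := by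
    rintro ⟨α, β⟩ hα hβ rfl
    have hα' := eq_single_of_coeff_seriesIn_ne_zero hα
    have hβ' := eq_single_of_coeff_seriesIn_ne_zero hβ
    generalize ofLex α s = i at hα'
    generalize ofLex β t = j at hβ'
    simp only at hα' hβ'
    subst hα' hβ'
    have h₁ := ofLex_single_add_single hst i j
    rw [h₁.1, h₁.2]
  rw [HahnSeries.coeff_mul]
  split_ifs with hγ
  · rw [Finset.sum_eq_single
      (toLex (Pi.single s (ofLex γ s)), toLex (Pi.single t (ofLex γ t)))]
    · simp [coeff_seriesIn]
    · intro p hp hne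
      rw [Finset.mem_antidiagonal] at hp
      exact absurd (hval p hp.1 hp.2.1 hp.2.2) hne
    · intro hp
      rw [Finset.mem_antidiagonal] at hp
      by_contra h
      exact hp ⟨left_ne_zero_of_mul h, right_ne_zero_of_mul h, hγ.symm⟩
  · refine Finset.sum_eq_zero fun p hp => ?_
    rw [Finset.mem_antidiagonal] at hp
    have h := hval p hp.1 hp.2.1 hp.2.2
    rw [h] at hp
    exact absurd hp.2.2.symm hγ

end Series

/-- All four indices are odd, so the entries are even and the graded commutator is the ordinary one.
The sign exponent is 3, which reverses the difference on the right. -/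
theorem RTTRelation.row {K A : Type*} [Field K] [Ring A] [Algebra K A] {c x y : K}
    {Tx Ty : Fin 3 → Fin 3 → A} (hT : RTTRelation c x y Tx Ty) (k l : Fin 2) :
    Tx 1 k.succ * Ty 1 l.succ - Ty 1 l.succ * Tx 1 k.succ =
      g c x y • (Ty 1 l.succ * Tx 1 k.succ - Tx 1 l.succ * Ty 1 k.succ) := by
  have h := hT 1 k.succ 1 l.succ
  have hgr : gr 1 = 1 := rfl
  simp only [scomm, gr_succ, hgr] at h
  norm_num at h
  rw [h, ← smul_neg, neg_sub]

section Formal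

variable {n : ℕ} {c : ℂ}

theorem formalParam_eq (c : ℂ) (n : ℕ) (s : Fin n) :
    formalParam c n s = HahnSeries.C c * HahnSeries.single (-powEmb n s 1) 1 := by
  rw [formalParam, div_eq_mul_inv, HahnSeries.inv_single, inv_one]

theorem single_neg_powEmb_injective (n : ℕ) : Function.Injective fun s : Fin n =>
    (HahnSeries.single (-powEmb n s 1) (1 : ℂ) : Scal n) := by
  intro s t hst
  have h := congrArg (fun x : Scal n => x.coeff (-powEmb n s 1)) hst
  simp only [HahnSeries.coeff_single_same] at h
  by_contra hne
  rw [HahnSeries.coeff_single_of_ne] at h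
  · exact one_ne_zero h
  · intro h'
    have := congrArg (fun γ : Expo n => ofLex γ s) (neg_injective h')
    simp [powEmb_apply, hne] at this

theorem formalParam_injective (hc : c ≠ 0) : Function.Injective (formalParam c n) := by
  intro s t hst
  rw [formalParam_eq, formalParam_eq] at hst
  exact single_neg_powEmb_injective n (mul_left_cancel₀ (HahnSeries.C_ne_zero hc) hst)

theorem neg_one_mul_sub {B : Type*} [Ring B] (x y : B) : -1 * (x - y) = y - x := by
  rw [neg_one_mul, neg_sub]

theorem coeffT_relation (k l : Fin 2) (p q : ℕ) :
    (coeffT 1 k.succ (p + 1) * coeffT 1 l.succ q - coeffT 1 l.succ q * coeffT 1 k.succ (p + 1)) -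
      (coeffT 1 k.succ p * coeffT 1 l.succ (q + 1) -
        coeffT 1 l.succ (q + 1) * coeffT 1 k.succ p) =
      coeffT 1 l.succ q * coeffT 1 k.succ p - coeffT 1 l.succ p * coeffT 1 k.succ q := by
  have h := RingQuot.mkAlgHom_rel ℂ (YRel.rtt 1 k.succ 1 l.succ p q)
  have h1 : gr 1 = 1 := rfl
  simp only [scomm, gr_succ, h1, map_sub, map_mul, map_pow, map_neg, map_one] at h
  simp only [coeffT]
  norm_num at h
  exact h.trans (neg_one_mul_sub _ _)

theorem coeffT_zero (i j : Fin 3) : coeffT i j 0 = if i = j then 1 else 0 := by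
  rw [coeffT, freeCoeff]
  split_ifs <;> simp

theorem commute_extendZero_coeffT (i j : Fin 3) {m : ℤ} (hm : m < 0) (y : Y) :
    Commute (extendZero (coeffT i j) (m + 1)) y := by
  rcases lt_or_ge (m + 1) 0 with h | h
  · rw [extendZero_of_neg _ h]
    exact Commute.zero_left y
  · obtain h' : m + 1 = ((0 : ℕ) : ℤ) := by omega
    rw [h', extendZero_natCast, coeffT_zero]
    split_ifs
    · exact Commute.one_left y
    · exact Commute.zero_left y

/-- Extending the mode relations to integer exponents makes them comparable with coefficients of
Laurent series. The boundary case is exponent `-1`, where the shifted mode is the constant term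
`δ_{ij}`, which is central; below it everything vanishes. -/
theorem extendZero_coeffT_relation (k l : Fin 2) (p q : ℤ) :
    (extendZero (coeffT 1 k.succ) (p + 1) * extendZero (coeffT 1 l.succ) q -
        extendZero (coeffT 1 l.succ) q * extendZero (coeffT 1 k.succ) (p + 1)) -
      (extendZero (coeffT 1 k.succ) p * extendZero (coeffT 1 l.succ) (q + 1) -
        extendZero (coeffT 1 l.succ) (q + 1) * extendZero (coeffT 1 k.succ) p) =
      extendZero (coeffT 1 l.succ) q * extendZero (coeffT 1 k.succ) p -
        extendZero (coeffT 1 l.succ) p * extendZero (coeffT 1 k.succ) q := by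
  rcases lt_or_ge p 0 with hp | hp
  · rw [(commute_extendZero_coeffT 1 k.succ hp _).eq]
    simp [extendZero_of_neg _ hp]
  rcases lt_or_ge q 0 with hq | hq
  · rw [(commute_extendZero_coeffT 1 l.succ hq _).eq]
    simp [extendZero_of_neg _ hq]
  lift p to ℕ using hp
  lift q to ℕ using hq
  have h := coeffT_relation k l p q
  simpa only [← extendZero_natCast (coeffT _ _), Nat.cast_add, Nat.cast_one] using h

theorem formalG_eq (hc : c ≠ 0) (s t : Fin n) :
    g (HahnSeries.C c) (formalParam c n s) (formalParam c n t) =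
      (HahnSeries.single (-powEmb n s 1) 1 - HahnSeries.single (-powEmb n t 1) 1)⁻¹ := by
  rw [g, formalParam_eq, formalParam_eq, ← mul_sub, div_mul_eq_div_div,
    div_self (HahnSeries.C_ne_zero hc), one_div]

theorem single_smul_coeff (α γ : Expo n) (x : YSer n) :
    ((HahnSeries.single (-α) (1 : ℂ) : Scal n) • x).coeff γ = x.coeff (γ + α) := by
  have h : scalarMap n (HahnSeries.single (-α) 1) = HahnSeries.single (-α) 1 := by
    ext δ
    change algebraMap ℂ Y ((HahnSeries.single (-α) (1 : ℂ) : Scal n).coeff δ) = _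
    rw [HahnSeries.coeff_single, HahnSeries.coeff_single]
    split_ifs <;> simp
  rw [Algebra.smul_def]
  change (scalarMap n _ * x).coeff γ = _
  rw [h, HahnSeries.coeff_single_mul, one_mul, sub_neg_eq_add]

/-- Multiplying by `1/g = x_s⁻¹ - x_t⁻¹` clears the denominator. Each inverse monomial shifts
exponents by one, so comparison of coefficients gives the mode relations. -/
theorem formalT_row_relation (hc : c ≠ 0) {s t : Fin n} (hst : s ≠ t) (k l : Fin 2) :
    formalT n s 1 k.succ * formalT n t 1 l.succ - formalT n t 1 l.succ * formalT n s 1 k.succ =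
      g (HahnSeries.C c) (formalParam c n s) (formalParam c n t) •
        (formalT n t 1 l.succ * formalT n s 1 k.succ -
          formalT n s 1 l.succ * formalT n t 1 k.succ) := by
  have hne : (HahnSeries.single (-powEmb n s 1) 1 - HahnSeries.single (-powEmb n t 1) 1 :
      Scal n) ≠ 0 := sub_ne_zero.2 fun h => hst (single_neg_powEmb_injective n h)
  rw [formalG_eq hc, eq_inv_smul_iff₀ hne]
  refine (sub_smul (HahnSeries.single (-powEmb n s 1) 1 : Scal n)
    (HahnSeries.single (-powEmb n t 1) 1) (formalT n s 1 k.succ * formalT n t 1 l.succ -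
      formalT n t 1 l.succ * formalT n s 1 k.succ)).trans ?_
  have hs : ∀ γ : Expo n, ofLex (γ + powEmb n s 1) s = ofLex γ s + 1 ∧
      ofLex (γ + powEmb n s 1) t = ofLex γ t := by
    intro γ
    have h : ∀ i, ofLex (γ + powEmb n s 1) i = ofLex γ i + (Pi.single s 1 : Fin n → ℤ) i :=
      fun i => rfl
    simp [h, hst.symm]
  have ht : ∀ γ : Expo n, ofLex (γ + powEmb n t 1) s = ofLex γ s ∧
      ofLex (γ + powEmb n t 1) t = ofLex γ t + 1 := by
    intro γ
    have h : ∀ i, ofLex (γ + powEmb n t 1) i = ofLex γ i + (Pi.single t 1 : Fin n → ℤ) i :=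
      fun i => rfl
    simp [h, hst]
  have hs' : ∀ γ : Expo n, γ + powEmb n s 1 =
      toLex (Pi.single s (ofLex γ s + 1)) + toLex (Pi.single t (ofLex γ t)) ↔
      γ = toLex (Pi.single s (ofLex γ s)) + toLex (Pi.single t (ofLex γ t)) := by
    intro γ
    rw [Pi.single_add, toLex_add, add_right_comm]
    exact add_left_inj _
  have ht' : ∀ γ : Expo n, γ + powEmb n t 1 =
      toLex (Pi.single s (ofLex γ s)) + toLex (Pi.single t (ofLex γ t + 1)) ↔
      γ = toLex (Pi.single s (ofLex γ s)) + toLex (Pi.single t (ofLex γ t)) := by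
    intro γ
    rw [Pi.single_add, toLex_add, ← add_assoc]
    exact add_left_inj _
  ext γ
  simp only [HahnSeries.coeff_sub, single_smul_coeff, formalT, coeff_seriesIn_mul hst,
    coeff_seriesIn_mul hst.symm, (hs γ).1, (hs γ).2, (ht γ).1, (ht γ).2,
    add_comm (toLex (Pi.single t _) : Expo n), hs', ht']
  split_ifs
  · exact extendZero_coeffT_relation k l _ _
  · simp

/-- The constant series is supported at exponent zero, so a series acts on it coefficient by
coefficient, and the eigenvalue equations of the modes carry over. -/
theorem formalT_smul_constVec {V : Type*} [AddCommGroup V] [Module Y V] {Ω : V} {lam : ℕ → ℂ}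
    {i : Fin 3} (h : ∀ p, coeffT i i p • Ω = algebraMap ℂ Y (lam p) • Ω) (s : Fin n) :
    formalT n s i i • constVec n Ω = formalLam n lam s • constVec n Ω := by
  have hcoeff : ∀ (x : YSer n) (γ : Expo n),
      ((HahnModule.of Y).symm (x • constVec n Ω)).coeff γ = x.coeff γ • Ω := by
    intro x γ
    rw [HahnModule.coeff_smul_right (s := {0}) (Set.isPWO_singleton 0)]
    · rw [Finset.sum_eq_single (γ, 0)]
      · simp [constVec]
      · rintro ⟨α, β⟩ hp hne
        rw [Finset.mem_vaddAntidiagonal] at hp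
        obtain ⟨-, hβ, hγ⟩ := hp
        obtain rfl : β = 0 := hβ
        refine absurd ?_ hne
        rw [← hγ]
        simp
      · intro hp
        rw [Finset.mem_vaddAntidiagonal] at hp
        have : x.coeff γ = 0 := by
          by_contra hx
          exact hp ⟨hx, rfl, by simp⟩
        simp [this]
    · exact HahnSeries.support_single_subset
  refine HahnModule.ext _ _ (funext fun γ => ?_)
  change _ = ((HahnModule.of Y).symm (scalarMap n (formalLam n lam s) • constVec n Ω)).coeff γ
  rw [hcoeff, hcoeff]
  change _ = (algebraMap ℂ Y ((formalLam n lam s).coeff γ)) • Ω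
  rw [formalT, formalLam, coeff_seriesIn, coeff_seriesIn]
  split_ifs
  · rw [extendZero, extendZero]
    split_ifs
    · exact h _
    · simp
  · simp

instance instIsScalarTowerScal (n : ℕ) (V : Type*) [AddCommGroup V] [Module Y V] :
    IsScalarTower (Scal n) (YSer n) (VSer n V) where
  smul_assoc x y m := by
    rw [Algebra.smul_def]
    exact mul_smul (scalarMap n x) y m

instance instCharZeroScal (n : ℕ) : CharZero (Scal n) :=
  charZero_of_injective_ringHom (f := (HahnSeries.C : ℂ →+* Scal n)) HahnSeries.C_injective

theorem formalBethe_succ (hc : c ≠ 0) {V : Type*} [AddCommGroup V] [Module Y V] {Ω : V}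
    {lam : ℕ → ℂ} (hΩ : ∀ p, coeffT 1 1 p • Ω = algebraMap ℂ Y (lam p) • Ω) {a b : ℕ}
    (u : Fin (a + 1) → Fin n) (v : Fin b → Fin n) (hinj : Function.Injective (Sum.elim u v)) :
    formalBethe c n Ω u v =
      (∏ k, formalH c n (Fin.tail u k) (u 0))⁻¹ •
        (formalT n (u 0) 0 1 • formalBethe c n Ω (Fin.tail u) v) -
      (∏ k, formalH c n (Fin.tail u k) (u 0))⁻¹ •
        ∑ j, (formalLam n lam (v j) * formalG c n (u 0) (v j) *
            (∏ k, formalF c n (Fin.tail u k) (v j)) *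
            (∏ k, formalF c n (v j) (remove v j k))) •
          (formalT n (u 0) 0 2 • formalBethe c n Ω (Fin.tail u) (remove v j)) := by
  obtain ⟨-, hv, huv⟩ := Sum.elim_injective.1 hinj
  have hz := formalParam_injective (n := n) hc
  have h := betheVec_succ (K := Scal n) (A := YSer n) (M := VSer n V) (c := HahnSeries.C c)
    (z := formalParam c n) (T := formalT n) (Ω := constVec n Ω) (lam := formalLam n lam) u v
    (fun i j hij k l => formalT_row_relation hc (hv.ne hij) k l)
    (fun j => formalT_smul_constVec hΩ (v j)) (hz.comp hv) (fun k j => hz.ne (huv k j))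
  unfold formalBethe formalH formalG formalF
  convert h using 3

end Formal

end SuperYangian
open SuperYangian in
theorem mainTheorem4 :
    -- modules over `Y(1|2)`, with formal spectral parameters
    (∀ (c : ℂ), c ≠ 0 →
      ∀ (V : Type*) [AddCommGroup V] [Module Y V] (Ω : V) (lam : Fin 3 → ℕ → ℂ),
      (∀ i p, coeffT i i p • Ω = algebraMap ℂ Y (lam i p) • Ω) →
      (∀ i j p, j < i → coeffT i j p • Ω = 0) →
      ∀ (n a b : ℕ) (u : Fin (a + 1) → Fin n) (v : Fin b → Fin n),
      Function.Injective (Sum.elim u v) →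
      formalBethe c n Ω u v =
        (∏ k, formalH c n (Fin.tail u k) (u 0))⁻¹ •
          (formalT n (u 0) 0 1 • formalBethe c n Ω (Fin.tail u) v) -
        (∏ k, formalH c n (Fin.tail u k) (u 0))⁻¹ •
          ∑ j, (formalLam n (lam 1) (v j) * formalG c n (u 0) (v j) *
              (∏ k, formalF c n (Fin.tail u k) (v j)) *
              (∏ k, formalF c n (v j) (remove v j k))) •
            (formalT n (u 0) 0 2 • formalBethe c n Ω (Fin.tail u) (remove v j))) ∧
    -- representations in which `T(u)` is evaluated at complex values of `u`
    (∀ (c : ℂ), c ≠ 0 →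
      ∀ (V : Type*) [AddCommGroup V] [Module ℂ V] (D : Set ℂ)
        (T : ℂ → Fin 3 → Fin 3 → Module.End ℂ V) (Ω : V) (lam : Fin 3 → ℂ → ℂ),
      (∀ x ∈ D, ∀ y ∈ D, x ≠ y → RTTRelation c x y (T x) (T y)) →
      (∀ x ∈ D, ∀ i, T x i i Ω = lam i x • Ω) →
      (∀ x ∈ D, ∀ i j, j < i → T x i j Ω = 0) →
      ∀ (a b : ℕ) (u : Fin (a + 1) → ℂ) (v : Fin b → ℂ),
      (∀ k, u k ∈ D) → (∀ j, v j ∈ D) → Function.Injective (Sum.elim u v) →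
      (∀ k l, k < l → h c (u l) (u k) ≠ 0) →
      betheVec c id T Ω u v =
        (∏ k, h c (Fin.tail u k) (u 0))⁻¹ •
          T (u 0) 0 1 (betheVec c id T Ω (Fin.tail u) v) -
        (∏ k, h c (Fin.tail u k) (u 0))⁻¹ •
          ∑ j, (lam 1 (v j) * g c (u 0) (v j) *
              (∏ k, f c (Fin.tail u k) (v j)) *
              (∏ k, f c (v j) (remove v j k))) •
            T (u 0) 0 2 (betheVec c id T Ω (Fin.tail u) (remove v j))) := by
  refine ⟨?_, ?_⟩
  · intro c hc V _ _ Ω lam hdiag _ n a b u v hinj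
    exact formalBethe_succ hc (hdiag 1) u v hinj
  · intro c hc V _ _ D T Ω lam hrtt hdiag _ a b u v _ hvD hinj _
    obtain ⟨-, hv, huv⟩ := Sum.elim_injective.1 hinj
    refine betheVec_succ (M := V) (z := id) (lam := lam 1) u v (fun i j hij k l => ?_)
      (fun j => hdiag _ (hvD j) 1) hv huv
    exact (hrtt _ (hvD i) _ (hvD j) (hv.ne hij)).row k l
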